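/- **Conventions.** All groupoids are étale topological groupoids $\mathcal G$ (continuous structure maps, range $r$ and source $s\colon \mathcal G\to\mathcal G^0$ local homeomorphisms). Such a groupoid is locally compact if $\mathcal G^0$ is Hausdorff and locally compact. A groupoid correspondence $\mathcal X\colon\mathcal H\leftarrow\mathcal G$ is a topological space with commuting continuous actions of $\mathcal H$ on the left (anchor map $r\colon \mathcal X\to\mathcal H^0$) and of $\mathcal G$ on the right (anchor map $s\colon \mathcal X\to\mathcal G^0$), such that $s$ is a local homeomorphism and $(x,g)\mapsto (x,x\cdot g)$ is a homeomorphism from $\mathcal X\times_{s,\mathcal G^0,r}\mathcal G$ onto its image in $\mathcal X\times\mathcal X$. It is proper if the induced map $r_*\colon\mathcal X/\mathcal G\to\mathcal H^0$ is proper, and it is locally compact if $\mathcal H$, $\mathcal G$ are locally compact and $\mathcal X/\mathcal G$ is Hausdorff. The composite $\mathcal X\circ_{\mathcal G}\mathcal Y$ is the quotient of $\mathcal X\times_{s,\mathcal G^0,r}\mathcal Y$ by $(x\cdot g,y)\sim(x,g\cdot y)$. Let $\mathcal C$ be a category with object set $\mathcal C^0$. A $\mathcal C$-shaped diagram $F$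 of groupoid correspondences consists of groupoids $\mathcal G_x$ for $x\in\mathcal C^0$, correspondences $\mathcal X_g\colon\mathcal G_{x'}\leftarrow\mathcal G_x$ for arrows $g\colon x'\leftarrow x$, and isomorphisms of correspondences $\mu_{g,h}\colon\mathcal X_g\circ\mathcal X_h\cong\mathcal X_{gh}$ for composable $g,h$, written $\gamma_1\cdot\gamma_2$, together with isomorphisms of correspondences $\mathcal X_{\mathrm{id}_x}\cong\mathcal G_x$, through which $\mu_{g,\mathrm{id}}$ and $\mu_{\mathrm{id},g}$ become the canonical maps given by the groupoid actions; the $\mu_{g,h}$ are associative. The diagram is proper (locally compact) if all $\mathcal G_x$ and $\mathcal X_g$ are so, where this makes sense. Let $\mathcal G^0:=\bigsqcup_{x\in\mathcal C^0}\mathcal G^0_x$. An $F$-action on a topological space $Y$ consists of a partition $Y=\bigsqcup_{x\in\mathcal C^0}Y_x$ into clopen subsets, continuous maps $r\colon Y_x\to\mathcal G_x^0$, and open, continuous, surjective maps $\mathcal X_g\times_{s,\mathcal G_x^0,r}Y_x\to Y_{x'}$, $(\gamma,y)\mapsto\gamma\cdot y$, for arrows $g\colon x'\leftarrow x$, such that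 (1) $r(\gamma_2\cdot y)=r(\gamma_2)$ and $\gamma_1\cdot(\gamma_2\cdot y)=(\gamma_1\cdot\gamma_2)\cdot y$ whenever $s(\gamma_1)=r(\gamma_2)$ and $s(\gamma_2)=r(y)$; and (2) if $\gamma\cdot y=\gamma'\cdot y'$ with $\gamma,\gamma'\in\mathcal X_g$ and $y,y'\in Y_x$, then there is $\eta\in\mathcal G_x$ with $\gamma'=\gamma\cdot\eta$ and $y=\eta\cdot y'$. The maps $r$ combine to a continuous anchor map $r_Y\colon Y\to\mathcal G^0$. The morphisms in the category of $F$-actions are the continuous $F$-equivariant maps, that is, the continuous maps $\varphi$ that respect the partitions and anchor maps and satisfy $\varphi(\gamma\cdot y)=\gamma\cdot\varphi(y)$. For a locally compact Hausdorff space $B$ and a continuous map $r\colon Y\to B$, the relative Stone–Čech compactification $\beta_BY$ is the spectrum of the commutative $C^*$-algebra $C_b(Y)\cdot r^*(C_0(B))\subseteq C_b(Y)$ (the closed linear span of the products), and $i_Y\colon Y\to\beta_BY$ sends $y$ to evaluation at $y$. **Proposition.** Let $F$ be a proper, locally compact $\mathcal C$-shaped diagram of groupoid correspondences. For every $F$-action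 on a topological space $Y$ there is a unique $F$-action on $\beta_{\mathcal G^0}Y$ for which $i_Y\colon Y\to\beta_{\mathcal G^0}Y$ is $F$-equivariant; call it the induced action. The full subcategory of those $F$-actions whose underlying space is Hausdorff and whose anchor map to $\mathcal G^0$ is proper is a reflective subcategory of the category of all $F$-actions. The left adjoint of the inclusion maps an $F$-action on $Y$ to the induced $F$-action on $\beta_{\mathcal G^0}Y$, and the unit of the adjunction at $Y$ is $i_Y$. -/

import Mathlib

open CategoryTheory Topology
open scoped BoundedContinuousFunction ZeroAtInfty

universe w v u t

/-! ## Étale groupoids and groupoid correspondences -/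

/-- An étale topological groupoid, with space of objects `Obj`, space of arrows `Arr`, range map
`r` and source map `s`.  The product `mul g h` is defined when `s g = r h`. -/
structure EtaleGroupoid : Type (w + 1) where
  Obj : Type w
  Arr : Type w
  [topObj : TopologicalSpace Obj]
  [topArr : TopologicalSpace Arr]
  r : Arr → Obj
  s : Arr → Obj
  one : Obj → Arr
  inv : Arr → Arr
  mul : (g h : Arr) → s g = r h → Arr
  isLocalHomeomorph_r : IsLocalHomeomorph r
  isLocalHomeomorph_s : IsLocalHomeomorph s
  continuous_one : Continuous one
  continuous_inv : Continuous inv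
  continuous_mul :
    Continuous fun p : {p : Arr × Arr // s p.1 = r p.2} => mul p.1.1 p.1.2 p.2
  r_one : ∀ x, r (one x) = x
  s_one : ∀ x, s (one x) = x
  r_inv : ∀ g, r (inv g) = s g
  s_inv : ∀ g, s (inv g) = r g
  r_mul : ∀ g h e, r (mul g h e) = r g
  s_mul : ∀ g h e, s (mul g h e) = s h
  one_mul : ∀ g, mul (one (r g)) g (s_one _) = g
  mul_one : ∀ g, mul g (one (s g)) (r_one _).symm = g
  mul_inv : ∀ g, mul g (inv g) (r_inv g).symm = one (r g)
  inv_mul : ∀ g, mul (inv g) g (s_inv g) = one (s g)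
  mul_assoc : ∀ g h k (e₁ : s g = r h) (e₂ : s h = r k),
    mul (mul g h e₁) k ((s_mul g h e₁).trans e₂) = mul g (mul h k e₂) (e₁.trans (r_mul h k e₂).symm)

attribute [instance] EtaleGroupoid.topObj EtaleGroupoid.topArr

/-- A groupoid is locally compact if its object space is Hausdorff and locally compact. -/
class EtaleGroupoid.IsLocallyCompact (G : EtaleGroupoid.{w}) : Prop where
  t2 : T2Space G.Obj
  locallyCompact : LocallyCompactSpace G.Obj

/-- An étale groupoid correspondence `H ← G`: a space with commuting actions of `H` on the left
(with anchor map `r`) and of `G` on the right (with anchor map `s`), such that `s` is a local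
homeomorphism and the right action is basic, that is, `(x, g) ↦ (x, x · g)` is a homeomorphism
onto its image. -/
structure GrpdCorr (H G : EtaleGroupoid.{w}) : Type (w + 1) where
  carrier : Type w
  [top : TopologicalSpace carrier]
  r : carrier → H.Obj
  s : carrier → G.Obj
  lact : (h : H.Arr) → (x : carrier) → H.s h = r x → carrier
  ract : (x : carrier) → (g : G.Arr) → s x = G.r g → carrier
  continuous_r : Continuous r
  continuous_lact :
    Continuous fun p : {p : H.Arr × carrier // H.s p.1 = r p.2} => lact p.1.1 p.1.2 p.2
  continuous_ract :
    Continuous fun p : {p : carrier × G.Arr // s p.1 = G.r p.2} => ract p.1.1 p.1.2 p.2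
  r_lact : ∀ h x e, r (lact h x e) = H.r h
  s_lact : ∀ h x e, s (lact h x e) = s x
  r_ract : ∀ x g e, r (ract x g e) = r x
  s_ract : ∀ x g e, s (ract x g e) = G.s g
  one_lact : ∀ x, lact (H.one (r x)) x (H.s_one _) = x
  ract_one : ∀ x, ract x (G.one (s x)) (G.r_one _).symm = x
  mul_lact : ∀ h k x (e₁ : H.s h = H.r k) (e₂ : H.s k = r x),
    lact (H.mul h k e₁) x ((H.s_mul h k e₁).trans e₂) =
      lact h (lact k x e₂) (e₁.trans (r_lact k x e₂).symm)
  ract_mul : ∀ x g k (e₁ : s x = G.r g) (e₂ : G.s g = G.r k),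
    ract x (G.mul g k e₂) (e₁.trans (G.r_mul g k e₂).symm) =
      ract (ract x g e₁) k ((s_ract x g e₁).trans e₂)
  lact_ract : ∀ h x g (e₁ : H.s h = r x) (e₂ : s x = G.r g),
    ract (lact h x e₁) g ((s_lact h x e₁).trans e₂) =
      lact h (ract x g e₂) (e₁.trans (r_ract x g e₂).symm)
  isLocalHomeomorph_s : IsLocalHomeomorph s
  basic : IsEmbedding fun p : {p : carrier × G.Arr // s p.1 = G.r p.2} =>
    (p.1.1, ract p.1.1 p.1.2 p.2)

attribute [instance] GrpdCorr.top

namespace GrpdCorr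

variable {K H G : EtaleGroupoid.{w}}

/-- The orbit relation of the right `G`-action. -/
def orbitSetoid (X : GrpdCorr H G) : Setoid X.carrier where
  r x x' := ∃ (g : G.Arr) (e : X.s x = G.r g), x' = X.ract x g e
  iseqv :=
    { refl := fun x => ⟨_, _, (X.ract_one x).symm⟩
      symm := by
        rintro x _ ⟨g, e, rfl⟩
        refine ⟨G.inv g, (X.s_ract _ _ _).trans (G.r_inv g).symm, ?_⟩
        rw [← X.ract_mul x g (G.inv g) e (G.r_inv g).symm]
        simp only [G.mul_inv, ← e, X.ract_one]
      trans := by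
        rintro x _ _ ⟨g, e, rfl⟩ ⟨k, e', rfl⟩
        exact ⟨_, _, (X.ract_mul x g k e ((X.s_ract x g e).symm.trans e')).symm⟩ }

/-- The orbit space `X / G`, with the quotient topology. -/
abbrev OrbitSpace (X : GrpdCorr H G) : Type w := Quotient X.orbitSetoid

/-- The map `r_* : X / G → H⁰` induced by the left anchor map. -/
def rStar (X : GrpdCorr H G) : X.OrbitSpace → H.Obj :=
  Quotient.lift X.r (by rintro x _ ⟨g, e, rfl⟩; exact (X.r_ract x g e).symm)

/-- A correspondence is proper if `r_* : X / G → H⁰` is a proper map. -/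
def IsProper (X : GrpdCorr H G) : Prop := IsProperMap X.rStar

/-- The fibre product `X ×_{G⁰} Y` of two composable correspondences. -/
abbrev FibreProduct (X : GrpdCorr K H) (Y : GrpdCorr H G) : Type w :=
  {p : X.carrier × Y.carrier // X.s p.1 = Y.r p.2}

/-- The orbit relation of the diagonal action of the middle groupoid on the fibre product:
`(x · g, y)` and `(x, g · y)` are identified. -/
def compSetoid (X : GrpdCorr K H) (Y : GrpdCorr H G) : Setoid (FibreProduct X Y) where
  r p q := ∃ (g : H.Arr) (e₁ : X.s p.1.1 = H.r g) (e₂ : H.s g = Y.r q.1.2),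
    q.1.1 = X.ract p.1.1 g e₁ ∧ p.1.2 = Y.lact g q.1.2 e₂
  iseqv :=
    { refl := by
        rintro ⟨⟨x, y⟩, h⟩
        refine ⟨H.one (X.s x), (H.r_one _).symm, (H.s_one _).trans h, (X.ract_one x).symm, ?_⟩
        have hx : X.s x = Y.r y := h
        simp only [hx, Y.one_lact]
      symm := by
        rintro ⟨⟨x, y⟩, h⟩ ⟨⟨x', y'⟩, h'⟩ ⟨g, e₁, e₂, hx, hy⟩
        change X.s x = H.r g at e₁
        change H.s g = Y.r y' at e₂
        change x' = X.ract x g e₁ at hx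
        change y = Y.lact g y' e₂ at hy
        subst hx hy
        refine ⟨H.inv g, (X.s_ract _ _ _).trans (H.r_inv g).symm,
          (H.s_inv g).trans (Y.r_lact _ _ _).symm, ?_, ?_⟩
        · rw [← X.ract_mul x g (H.inv g) e₁ (H.r_inv g).symm]
          simp only [H.mul_inv, ← e₁, X.ract_one]
        · rw [← Y.mul_lact (H.inv g) g y' (H.s_inv g) e₂]
          simp only [H.inv_mul, e₂, Y.one_lact]
      trans := by
        rintro ⟨⟨x, y⟩, h⟩ ⟨⟨x', y'⟩, h'⟩ ⟨⟨x'', y''⟩, h''⟩ ⟨g, e₁, e₂, hx, hy⟩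
          ⟨k, e₃, e₄, hx', hy'⟩
        change X.s x = H.r g at e₁
        change H.s g = Y.r y' at e₂
        change x' = X.ract x g e₁ at hx
        change y = Y.lact g y' e₂ at hy
        change X.s x' = H.r k at e₃
        change H.s k = Y.r y'' at e₄
        change x'' = X.ract x' k e₃ at hx'
        change y' = Y.lact k y'' e₄ at hy'
        subst hx hx' hy' hy
        have e : H.s g = H.r k := (X.s_ract x g e₁).symm.trans e₃
        exact ⟨H.mul g k e, e₁.trans (H.r_mul _ _ _).symm, (H.s_mul _ _ _).trans e₄,
          (X.ract_mul x g k e₁ e).symm, (Y.mul_lact g k y'' e e₄).symm⟩ }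

/-- The underlying space of the composite correspondence `X ∘_H Y`, with the quotient topology. -/
abbrev Comp (X : GrpdCorr K H) (Y : GrpdCorr H G) : Type w := Quotient (compSetoid X Y)

/-- The class `[x, y]` in the composite correspondence. -/
def Comp.mk {X : GrpdCorr K H} {Y : GrpdCorr H G} (x : X.carrier) (y : Y.carrier)
    (e : X.s x = Y.r y) : Comp X Y := Quotient.mk _ ⟨(x, y), e⟩

end GrpdCorr

/-! ## Diagrams of groupoid correspondences -/

/-- A `C`-shaped diagram of groupoid correspondences, that is, a homomorphism from the category
`C` to the bicategory of groupoid correspondences.  An arrow `f : x ⟶ y` gives a correspondence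
`X f : G y ← G x`, and `f ≫ g` is the composite of first `f`, then `g`.

The multiplication maps `μ` and the unit maps `ν` are isomorphisms of correspondences: they are
homeomorphisms that preserve both anchor maps and commute with both actions; the actions on the
composite correspondence are `k · [x, y] · g = [k · x, y · g]`.  The map `ν x` identifies
`X (𝟙 x)` with the identity correspondence `G x`, on which `G x` acts by left and right
multiplication. -/
structure CorrDiagram (C : Type u) [Category.{v} C] : Type (max u v (w + 1)) where
  G : C → EtaleGroupoid.{w}
  X : {x y : C} → (x ⟶ y) → GrpdCorr (G y) (G x)
  μ : {x y z : C} → (f : x ⟶ y) → (g : y ⟶ z) →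
    GrpdCorr.Comp (X g) (X f) ≃ₜ (X (f ≫ g)).carrier
  ν : (x : C) → (G x).Arr ≃ₜ (X (𝟙 x)).carrier
  r_μ : ∀ {x y z : C} (f : x ⟶ y) (g : y ⟶ z) a b e,
    (X (f ≫ g)).r (μ f g (.mk a b e)) = (X g).r a
  s_μ : ∀ {x y z : C} (f : x ⟶ y) (g : y ⟶ z) a b e,
    (X (f ≫ g)).s (μ f g (.mk a b e)) = (X f).s b
  lact_μ : ∀ {x y z : C} (f : x ⟶ y) (g : y ⟶ z) a b e k (e' : (G z).s k = (X g).r a),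
    μ f g (.mk ((X g).lact k a e') b (((X g).s_lact k a e').trans e)) =
      (X (f ≫ g)).lact k (μ f g (.mk a b e)) (e'.trans (r_μ f g a b e).symm)
  ract_μ : ∀ {x y z : C} (f : x ⟶ y) (g : y ⟶ z) a b e k (e' : (X f).s b = (G x).r k),
    μ f g (.mk a ((X f).ract b k e') (e.trans ((X f).r_ract b k e').symm)) =
      (X (f ≫ g)).ract (μ f g (.mk a b e)) k ((s_μ f g a b e).trans e')
  r_ν : ∀ x η, (X (𝟙 x)).r (ν x η) = (G x).r η
  s_ν : ∀ x η, (X (𝟙 x)).s (ν x η) = (G x).s η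
  lact_ν : ∀ x k η (e : (G x).s k = (G x).r η),
    ν x ((G x).mul k η e) = (X (𝟙 x)).lact k (ν x η) (e.trans (r_ν x η).symm)
  ract_ν : ∀ x k η (e : (G x).s η = (G x).r k),
    ν x ((G x).mul η k e) = (X (𝟙 x)).ract (ν x η) k ((s_ν x η).trans e)
  /-- `μ` for `f` and an identity arrow on the right is the canonical map `[a, η] ↦ a · η`. -/
  μ_unit_right : ∀ {x y : C} (f : x ⟶ y) a η (e : (X f).s a = (G x).r η),
    Category.id_comp f ▸ μ (𝟙 x) f (.mk a (ν x η) (e.trans (r_ν x η).symm)) = (X f).ract a η e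
  /-- `μ` for `f` and an identity arrow on the left is the canonical map `[η, a] ↦ η · a`. -/
  μ_unit_left : ∀ {x y : C} (f : x ⟶ y) a η (e : (G y).s η = (X f).r a),
    Category.comp_id f ▸ μ f (𝟙 y) (.mk (ν y η) a ((s_ν y η).trans e)) = (X f).lact η a e
  /-- `(a · b) · c = a · (b · c)`. -/
  μ_assoc : ∀ {x₃ x₂ x₁ x₀ : C} (h : x₃ ⟶ x₂) (g : x₂ ⟶ x₁) (f : x₁ ⟶ x₀) a b c
    (e₁ : (X f).s a = (X g).r b) (e₂ : (X g).s b = (X h).r c),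
    μ h (g ≫ f) (.mk (μ g f (.mk a b e₁)) c ((s_μ g f a b e₁).trans e₂)) =
      Category.assoc h g f ▸
        μ (h ≫ g) f (.mk a (μ h g (.mk b c e₂)) (e₁.trans (r_μ h g b c e₂).symm))

namespace CorrDiagram

variable {C : Type u} [Category.{v} C]

/-- A diagram is proper if all its correspondences are proper. -/
def IsProper (F : CorrDiagram.{w} C) : Prop :=
  ∀ (x y : C) (f : x ⟶ y), (F.X f).IsProper

/-- A diagram is locally compact if all its groupoids are locally compact and all its
correspondences are locally compact, that is, their orbit spaces are Hausdorff. -/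
class IsLocallyCompact (F : CorrDiagram.{w} C) : Prop where
  groupoid : ∀ x, (F.G x).IsLocallyCompact
  orbitSpace_t2 : ∀ {x y : C} (f : x ⟶ y), T2Space (F.X f).OrbitSpace

/-- The space `G⁰`, the disjoint union of the object spaces `Gₓ⁰`. -/
abbrev Obj (F : CorrDiagram.{w} C) : Type (max u w) := Σ x : C, (F.G x).Obj

instance (F : CorrDiagram.{w} C) [h : F.IsLocallyCompact] : T2Space F.Obj :=
  haveI := fun x => (h.groupoid x).t2
  inferInstance

instance (F : CorrDiagram.{w} C) [h : F.IsLocallyCompact] : LocallyCompactSpace F.Obj :=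
  haveI := fun x => (h.groupoid x).locallyCompact
  { local_compact_nhds := by
      rintro ⟨x, y⟩ n hn
      rw [Sigma.nhds_mk, Filter.mem_map] at hn
      obtain ⟨K, hK, hKn, hc⟩ := local_compact_nhds hn
      refine ⟨Sigma.mk x '' K, ?_, Set.image_subset_iff.2 hKn, hc.image continuous_sigmaMk⟩
      rw [Sigma.nhds_mk]
      exact Filter.image_mem_map hK }

/-! ## Actions of diagrams -/

/-- An `F`-action on a space `Y`.  The partition of `Y` into clopen subsets
`Yₓ = {y | idx y = x}` is encoded by the map `idx`.  The map `act g` is defined on the fibre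
product of `F.X g` and `Yₓ` over `Gₓ⁰`. -/
structure Action (F : CorrDiagram.{w} C) (Y : Type t) [TopologicalSpace Y] where
  idx : Y → C
  isClopen_idx : ∀ x, IsClopen {y | idx y = x}
  r : (x : C) → {y // idx y = x} → (F.G x).Obj
  continuous_r : ∀ x, Continuous (r x)
  act : {x x' : C} → (g : x ⟶ x') → (γ : (F.X g).carrier) → (y : {y // idx y = x}) →
    (F.X g).s γ = r x y → {y // idx y = x'}
  continuous_act : ∀ {x x' : C} (g : x ⟶ x'),
    Continuous fun p : {p : (F.X g).carrier × {y // idx y = x} // (F.X g).s p.1 = r x p.2} =>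
      act g p.1.1 p.1.2 p.2
  isOpenMap_act : ∀ {x x' : C} (g : x ⟶ x'),
    IsOpenMap fun p : {p : (F.X g).carrier × {y // idx y = x} // (F.X g).s p.1 = r x p.2} =>
      act g p.1.1 p.1.2 p.2
  surjective_act : ∀ {x x' : C} (g : x ⟶ x') (z : {y // idx y = x'}),
    ∃ γ y e, act g γ y e = z
  r_act : ∀ {x x' : C} (g : x ⟶ x') γ y e, r x' (act g γ y e) = (F.X g).r γ
  act_act : ∀ {x x' x'' : C} (g₂ : x ⟶ x') (g₁ : x' ⟶ x'') γ₁ γ₂ y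
    (e₁ : (F.X g₁).s γ₁ = (F.X g₂).r γ₂) (e₂ : (F.X g₂).s γ₂ = r x y),
    act g₁ γ₁ (act g₂ γ₂ y e₂) (e₁.trans (r_act g₂ γ₂ y e₂).symm) =
      act (g₂ ≫ g₁) (F.μ g₂ g₁ (.mk γ₁ γ₂ e₁)) y ((F.s_μ g₂ g₁ γ₁ γ₂ e₁).trans e₂)
  exists_of_act_eq : ∀ {x x' : C} (g : x ⟶ x') γ y e γ' y' e',
    act g γ y e = act g γ' y' e' →
      ∃ (η : (F.G x).Arr) (h₁ : (F.X g).s γ = (F.G x).r η) (h₂ : (F.G x).s η = r x y'),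
        γ' = (F.X g).ract γ η h₁ ∧ y = act (𝟙 x) (F.ν x η) y' ((F.s_ν x η).trans h₂)

namespace Action

variable {F : CorrDiagram.{w} C} {Y Z W : Type*} [TopologicalSpace Y] [TopologicalSpace Z]
  [TopologicalSpace W]

/-- The anchor map `Y → G⁰` assembled from the maps `Yₓ → Gₓ⁰`. -/
def anchorFun (A : F.Action Y) (y : Y) : F.Obj := ⟨A.idx y, A.r _ ⟨y, rfl⟩⟩

theorem continuous_anchorFun (A : F.Action Y) : Continuous A.anchorFun := by
  rw [continuous_iff_continuousAt]
  intro y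
  have ho : IsOpen {z | A.idx z = A.idx y} := (A.isClopen_idx _).isOpen
  have : ContinuousOn A.anchorFun {z | A.idx z = A.idx y} := by
    rw [continuousOn_iff_continuous_domRestrict]
    have h : Set.domRestrict {z | A.idx z = A.idx y} A.anchorFun =
        fun z => (⟨A.idx y, A.r (A.idx y) z⟩ : F.Obj) := by
      funext ⟨z, hz⟩
      have aux : ∀ x (hx : A.idx z = x), A.anchorFun z = ⟨x, A.r x ⟨z, hx⟩⟩ := by
        rintro _ rfl; rfl
      exact aux _ hz
    rw [h]
    exact continuous_sigmaMk.comp (A.continuous_r _)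
  exact this.continuousAt (ho.mem_nhds rfl)

/-- The anchor map `Y → G⁰` as a continuous map. -/
def anchor (A : F.Action Y) : C(Y, F.Obj) := ⟨A.anchorFun, A.continuous_anchorFun⟩

/-- `F`-equivariance of a continuous map: it respects the partitions, the anchor maps, and the
multiplication maps. -/
structure IsEquivariant (A : F.Action Y) (B : F.Action Z) (φ : C(Y, Z)) : Prop where
  idx_map : ∀ y, B.idx (φ y) = A.idx y
  r_map : ∀ x (y : {y // A.idx y = x}), B.r x ⟨φ y, (idx_map y).trans y.2⟩ = A.r x y
  act_map : ∀ {x x' : C} (g : x ⟶ x') γ y (e : (F.X g).s γ = A.r x y),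
    φ (A.act g γ y e) = B.act g γ ⟨φ y, (idx_map y).trans y.2⟩ (e.trans (r_map x y).symm)

theorem IsEquivariant.id (A : F.Action Y) : IsEquivariant A A (ContinuousMap.id Y) where
  idx_map _ := rfl
  r_map _ _ := rfl
  act_map _ _ _ _ := rfl

theorem IsEquivariant.comp {A : F.Action Y} {B : F.Action Z} {D : F.Action W} {ψ : C(Z, W)}
    {φ : C(Y, Z)} (hψ : IsEquivariant B D ψ) (hφ : IsEquivariant A B φ) :
    IsEquivariant A D (ψ.comp φ) where
  idx_map y := (hψ.idx_map _).trans (hφ.idx_map y)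
  r_map x y := (hψ.r_map x _).trans (hφ.r_map x y)
  act_map g γ y e := by
    have h := hψ.act_map g γ ⟨φ y, (hφ.idx_map y).trans y.2⟩ (e.trans (hφ.r_map _ y).symm)
    rw [← hφ.act_map g γ y e] at h
    exact h

end Action

/-- A topological space with an `F`-action. -/
structure ActionCat (F : CorrDiagram.{w} C) where
  carrier : Type t
  [top : TopologicalSpace carrier]
  action : F.Action carrier

attribute [instance] ActionCat.top

/-- Morphisms of `F`-actions are the continuous `F`-equivariant maps. -/
@[ext]
structure ActionCat.Hom {F : CorrDiagram.{w} C} (Y Z : ActionCat.{w, v, u, t} F) where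
  map : C(Y.carrier, Z.carrier)
  equivariant : Y.action.IsEquivariant Z.action map

/-- The category of `F`-actions on topological spaces. -/
instance (F : CorrDiagram.{w} C) : Category.{t} (ActionCat.{w, v, u, t} F) where
  Hom Y Z := ActionCat.Hom Y Z
  id Y := ⟨ContinuousMap.id _, .id _⟩
  comp f g := ⟨g.map.comp f.map, g.equivariant.comp f.equivariant⟩

/-- `F`-actions on Hausdorff spaces that are proper over `G⁰`. -/
def properHausdorff (F : CorrDiagram.{w} C) : ObjectProperty (ActionCat.{w, v, u, t} F) :=
  fun Y => T2Space Y.carrier ∧ IsProperMap Y.action.anchor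

end CorrDiagram

/-! ## The relative Stone–Čech compactification -/

section RelStoneCech

variable {B : Type*} {Y : Type t} [TopologicalSpace B] [TopologicalSpace Y]

/-- The products `φ · r^*(h)` for `φ ∈ C_b(Y)`, `h ∈ C₀(B)`. -/
def relProducts (r : C(Y, B)) : Set (Y →ᵇ ℂ) :=
  {f | ∃ (φ : Y →ᵇ ℂ) (h : C₀(B, ℂ)), f = φ * h.toBCF.compContinuous r}

theorem mul_mem_span_relProducts (r : C(Y, B)) {f : Y →ᵇ ℂ} (g : Y →ᵇ ℂ)
    (hf : f ∈ Submodule.span ℂ (relProducts r)) : g * f ∈ Submodule.span ℂ (relProducts r) := by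
  induction hf using Submodule.span_induction with
  | mem f hf =>
    obtain ⟨φ, h, rfl⟩ := hf
    exact Submodule.subset_span ⟨g * φ, h, (mul_assoc _ _ _).symm⟩
  | zero => simp
  | add f₁ f₂ _ _ h₁ h₂ => rw [mul_add]; exact add_mem h₁ h₂
  | smul c f _ h => rw [mul_smul_comm]; exact Submodule.smul_mem _ c h

theorem star_mem_span_relProducts (r : C(Y, B)) {f : Y →ᵇ ℂ}
    (hf : f ∈ Submodule.span ℂ (relProducts r)) : star f ∈ Submodule.span ℂ (relProducts r) := by
  induction hf using Submodule.span_induction with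
  | mem f hf =>
    obtain ⟨φ, h, rfl⟩ := hf
    refine Submodule.subset_span ⟨star φ, star h, ?_⟩
    ext y
    simp
  | zero => simp
  | add f₁ f₂ _ _ h₁ h₂ => rw [star_add]; exact add_mem h₁ h₂
  | smul c f _ h => rw [star_smul]; exact Submodule.smul_mem _ _ h

/-- The C⋆-subalgebra `C_b(Y) · r^*(C₀(B))` of `C_b(Y)`: the closed linear span of the products
`φ · r^*(h)`. -/
noncomputable def relAlgebra (r : C(Y, B)) : NonUnitalStarSubalgebra ℂ (Y →ᵇ ℂ) where
  __ := (Submodule.span ℂ (relProducts r)).topologicalClosure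
  mul_mem' hf hg :=
    map_mem_closure₂ continuous_mul hf hg fun a _ _ hb => mul_mem_span_relProducts r a hb
  star_mem' hf :=
    map_mem_closure continuous_star hf fun _ ha => star_mem_span_relProducts r ha

/-- The relative Stone–Čech compactification of `Y` over `B`: the spectrum of the commutative
C⋆-algebra `C_b(Y) · r^*(C₀(B))`, that is, its space of nonzero characters with the topology of
pointwise convergence. -/
abbrev RelStoneCech (r : C(Y, B)) : Type t := WeakDual.characterSpace ℂ (relAlgebra r)

variable [T2Space B] [LocallyCompactSpace B]

theorem exists_relAlgebra_ne_zero (r : C(Y, B)) (y : Y) : ∃ f : relAlgebra r, f.1 y ≠ 0 := by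
  obtain ⟨h, h1, -, hc, -⟩ := exists_continuous_one_zero_of_isCompact
    (isCompact_singleton (x := r y)) isClosed_empty (Set.disjoint_empty _)
  let k : C₀(B, ℂ) :=
    { toFun := fun b => (h b : ℂ)
      continuous_toFun := Complex.continuous_ofReal.comp h.continuous
      zero_at_infty' :=
        (HasCompactSupport.comp_left (g := fun t : ℝ => (t : ℂ)) hc
          Complex.ofReal_zero).is_zero_at_infty }
  refine ⟨⟨1 * k.toBCF.compContinuous r,
    subset_closure (Submodule.subset_span ⟨1, k, rfl⟩)⟩, ?_⟩
  have : h (r y) = 1 := h1 rfl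
  simp [k, this]

/-- The canonical map `Y → RelStoneCech r`, which sends `y` to the evaluation at `y`. -/
noncomputable def relStoneCechUnit (r : C(Y, B)) : C(Y, RelStoneCech r) where
  toFun y :=
    ⟨StrongDual.toWeakDual ((BoundedContinuousFunction.evalCLM ℂ y).comp
        (relAlgebra r).toNonUnitalSubalgebra.toSubmodule.subtypeL),
      by
        intro h
        obtain ⟨f, hf⟩ := exists_relAlgebra_ne_zero r y
        exact hf (DFunLike.congr_fun h f),
      fun _ _ => rfl⟩
  continuous_toFun := by
    refine Continuous.subtype_mk (WeakDual.continuous_of_continuous_eval fun f => ?_) _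
    exact f.1.continuous

theorem relStoneCechUnit_apply (r : C(Y, B)) (y : Y) (f : relAlgebra r) :
    relStoneCechUnit r y f = f.1 y := rfl

end RelStoneCech

namespace CorrDiagram

variable {C : Type u} [Category.{v} C]

/-- The Stone–Čech compactification of the space of an `F`-action relative to `G⁰`. -/
abbrev ActionCat.Beta {F : CorrDiagram.{w} C} (Y : ActionCat.{w, v, u, t} F) : Type t :=
  RelStoneCech Y.action.anchor

/-- The canonical map from the space of an `F`-action to its relative Stone–Čech
compactification. -/
noncomputable def ActionCat.toBeta {F : CorrDiagram.{w} C} [F.IsLocallyCompact]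
    (Y : ActionCat.{w, v, u, t} F) : C(Y.carrier, Y.Beta) :=
  relStoneCechUnit Y.action.anchor

end CorrDiagram

/-! Write `B` for `G⁰` and `βY` for the relative compactification. A character of the ideal
`relAlgebra r` extends to `C_b(Y)` and is approximated by points of `Y`. Hence `Y` is dense in `βY`,
and every bounded continuous function on `Y` converges along the trace on `Y` of the neighbourhood
filter of any point of `βY`. The map `r` then extends to a proper map `βY → B`
(`isProperMap_anchor`).

The main tool is `RelStoneCech.exists_extension`. Let `X → B` be étale, and let `Z` be Hausdorff and
proper over `B'`. A map `X ×_B Y → Z` lying over a continuous map `X → B'` extends to `X ×_B βY`.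
The reason is that `X` is locally an open subset of `B`, so, after a cut-off pulled back from `B`, a
bounded function on a piece of `X ×_B Y` becomes a bounded function on `Y`. The extension is unique
because `X ×_B Y` is dense in `X ×_B βY`.

This extends the multiplication maps to `βY`, and density gives associativity and the unit law.
Openness, surjectivity and condition (2) do not pass to closures directly. Together they are
obtained from a continuous inverse of the map from the orbit space of `X_g ×_B βY` to the part of
`βY` over `x'` (`exists_inverse_quotAct`). For `Y` itself such an inverse exists because `Y` carries
an action. Composed with `Y → βY`, it takes values in a space that is Hausdorff, because the right
action on `X_g` is basic with Hausdorff orbit space, and proper over the objects of `G x'`, because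
`X_g` and `βY → B` are proper. So the main tool extends the inverse as well.

Uniqueness of the induced action follows from density, and the reflection is the main tool for `X =
B`. The argument is carried out for `PreAction`, where multiplication is a partial map on the whole
space over `G⁰`, the base over which `βY` is formed. -/

/-! ## Extension of maps along dense maps -/

section Extension

open Filter

/-- A map into a regular space that converges along the traces of all neighbourhood filters
extends along a map with dense range. -/
theorem DenseRange.exists_continuous_extension {P Q Z : Type*} [TopologicalSpace Q]
    [TopologicalSpace Z] [T3Space Z] {j : P → Q} (hj : DenseRange j) (φ : P → Z)
    (h : ∀ q, ∃ z, Tendsto φ (comap j (𝓝 q)) (𝓝 z)) :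
    ∃ Φ : Q → Z, Continuous Φ ∧ ∀ p, Φ (j p) = φ p := by
  choose Φ hΦ using h
  refine ⟨Φ, continuous_iff_continuousAt.2 fun q => ?_, fun p => ?_⟩
  · refine (closed_nhds_basis (Φ q)).tendsto_right_iff.2 fun N hN => ?_
    -- The same `t` is a neighbourhood of every `q'` near `q`, so each such `Φ q'` is a limit of
    -- values in the closed set `N`.
    obtain ⟨t, ht, hsub⟩ := mem_comap.1 (hΦ q hN.1)
    filter_upwards [eventually_eventually_nhds.2 ht] with q' hq'
    have : (comap j (𝓝 q')).NeBot := comap_neBot fun _ ht => hj.mem_nhds ht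
    refine hN.2.mem_of_tendsto (hΦ q') ?_
    exact mem_comap.2 ⟨t, hq', hsub⟩
  -- The trace filter at `j p` contains the principal filter at `p`, along which `φ` is constant.
  · have h1 : Tendsto φ (pure p) (𝓝 (Φ (j p))) := by
      refine (hΦ (j p)).mono_left ?_
      rw [← map_le_iff_le_comap, Filter.map_pure]
      exact pure_le_nhds _
    exact (tendsto_nhds_unique h1 (tendsto_pure_nhds φ p))

/-- A map into a locally compact Hausdorff space converges if it does so along all ultrafilters
and all bounded continuous functions on the target converge. -/
theorem exists_tendsto_of_boundedContinuousFunction {P Z : Type*} [TopologicalSpace Z] [T2Space Z]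
    [LocallyCompactSpace Z] {l : Filter P} [l.NeBot] {φ : P → Z}
    (hb : ∀ ψ : Z →ᵇ ℂ, ∃ c, Tendsto (fun p => ψ (φ p)) l (𝓝 c))
    (hu : ∀ U : Ultrafilter P, ↑U ≤ l → ∃ z, Tendsto φ U (𝓝 z)) :
    ∃ z, Tendsto φ l (𝓝 z) := by
  obtain ⟨z, hz⟩ := hu (Ultrafilter.of l) (Ultrafilter.of_le l)
  refine ⟨z, tendsto_iff_ultrafilter _ _ _ |>.2 fun U hU => ?_⟩
  obtain ⟨z', hz'⟩ := hu U hU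
  suffices z' = z from this ▸ hz'
  by_contra hne
  -- Two distinct ultrafilter limits would be separated by a bounded function, which nevertheless
  -- has a single limit `c` along `l`.
  obtain ⟨f, h1, h0, -, h01⟩ := exists_continuous_one_zero_of_isCompact
    (isCompact_singleton (x := z')) (isClosed_singleton (x := z))
    (Set.disjoint_singleton.2 hne)
  let ψ : Z →ᵇ ℂ := BoundedContinuousFunction.ofNormedAddCommGroup (fun z => (f z : ℂ))
    (Complex.continuous_ofReal.comp f.continuous) 1 fun z => by
      simpa [abs_of_nonneg (h01 z).1] using (h01 z).2
  obtain ⟨c, hc⟩ := hb ψ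
  have e1 : ψ z' = c :=
    tendsto_nhds_unique ((ψ.continuous.tendsto z').comp hz') (hc.mono_left hU)
  have e2 : ψ z = c :=
    tendsto_nhds_unique ((ψ.continuous.tendsto z).comp hz) (hc.mono_left (Ultrafilter.of_le l))
  have h3 : f z' = f z := Complex.ofReal_injective (e1.trans e2.symm)
  rw [h1 rfl, h0 rfl] at h3
  exact one_ne_zero h3

/-- The total space of a proper map to a locally compact space is locally compact. -/
theorem IsProperMap.locallyCompactSpace {Z B : Type*} [TopologicalSpace Z] [TopologicalSpace B]
    [T2Space Z] [LocallyCompactSpace B] {p : Z → B} (hp : IsProperMap p) :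
    LocallyCompactSpace Z := by
  have : WeaklyLocallyCompactSpace Z := ⟨fun z => by
    obtain ⟨K, hK, hn⟩ := exists_compact_mem_nhds (p z)
    exact ⟨p ⁻¹' K, hp.isCompact_preimage hK, hp.continuous.continuousAt hn⟩⟩
  infer_instance

end Extension

/-! ## The relative Stone–Čech compactification -/

namespace RelStoneCech

open Filter

variable {B : Type*} {Y : Type t} [TopologicalSpace B] [TopologicalSpace Y]

theorem mul_mem (r : C(Y, B)) (f : Y →ᵇ ℂ) {a : Y →ᵇ ℂ} (ha : a ∈ relAlgebra r) :
    f * a ∈ relAlgebra r :=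
  map_mem_closure (f := fun b => f * b) (continuous_const.mul continuous_id) ha
    fun _ hb => mul_mem_span_relProducts r f hb

/-- Such an `a` serves as a denominator: `f ↦ χ (f * a)` extends `χ` to `C_b(Y)`, and `f = (f * a) /
a` near `χ`. -/
theorem exists_apply_eq_one {r : C(Y, B)} (χ : RelStoneCech r) : ∃ a : relAlgebra r, χ a = 1 := by
  obtain ⟨a, ha⟩ : ∃ a, χ a ≠ 0 := by
    by_contra! h
    exact χ.2.1 (DFunLike.ext _ _ h)
  exact ⟨(χ a)⁻¹ • a, by rw [map_smul, smul_eq_mul, inv_mul_cancel₀ ha]⟩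

/-- Characters of the ideal `relAlgebra r` extend to `C_b(Y)`. -/
theorem exists_algHom {r : C(Y, B)} (χ : RelStoneCech r) :
    ∃ Φ : (Y →ᵇ ℂ) →ₐ[ℂ] ℂ, ∀ a : relAlgebra r, Φ a.1 = χ a := by
  obtain ⟨a, ha⟩ := exists_apply_eq_one χ
  have hmul : ∀ f g : Y →ᵇ ℂ, χ ⟨f * g * a.1, mul_mem r _ a.2⟩ =
      χ ⟨f * a.1, mul_mem r _ a.2⟩ * χ ⟨g * a.1, mul_mem r _ a.2⟩ := by
    intro f g
    -- An additional factor `χ a = 1` turns both sides into the value of `χ` at `f * g * a * a`.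
    rw [← map_mul, ← mul_one (χ ⟨f * g * a.1, _⟩), ← ha, ← map_mul]
    congr 1
    refine Subtype.ext ?_
    change f * g * a.1 * a.1 = f * a.1 * (g * a.1)
    ring
  refine ⟨AlgHom.ofLinearMap
    { toFun := fun f => χ ⟨f * a.1, mul_mem r _ a.2⟩
      map_add' := fun f g => by
        rw [← map_add]
        congr 1
        refine Subtype.ext ?_
        exact add_mul _ _ _
      map_smul' := fun c f => by
        rw [RingHom.id_apply, ← map_smul]
        congr 1
        refine Subtype.ext ?_
        exact smul_mul_assoc _ _ _ } ?_ hmul, fun b => ?_⟩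
  · have h1 : (⟨1 * a.1, mul_mem r 1 a.2⟩ : relAlgebra r) = a := Subtype.ext (one_mul _)
    exact (congrArg χ h1).trans ha
  · change χ (b * a) = χ b
    rw [map_mul, ha, mul_one]

/-- A character of `C_b(Y)` belongs to the closure of the points of `Y`. -/
theorem exists_forall_norm_lt_one {ι : Type*} (Φ : (Y →ᵇ ℂ) →ₐ[ℂ] ℂ) (I : Finset ι)
    (g : ι → (Y →ᵇ ℂ)) (hg : ∀ i ∈ I, Φ (g i) = 0) : ∃ y, ∀ i ∈ I, ‖g i y‖ < 1 := by
  by_contra! hcon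
  -- If at every point some `‖g i y‖` is at least 1, then this sum of squares is bounded below by 1.
  -- It is therefore invertible in `C_b(Y)`, although `Φ` kills it.
  obtain ⟨k, hk, hky⟩ : ∃ k : Y →ᵇ ℂ, Φ k = 0 ∧ ∀ y, k y = ((∑ i ∈ I, ‖g i y‖ ^ 2 : ℝ) : ℂ) := by
    refine ⟨∑ i ∈ I, star (g i) * g i, ?_, fun y => ?_⟩
    · rw [map_sum]
      exact Finset.sum_eq_zero fun i hi => by rw [map_mul, hg i hi, mul_zero]
    · rw [BoundedContinuousFunction.coe_sum, Finset.sum_apply, Complex.ofReal_sum]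
      refine Finset.sum_congr rfl fun i _ => ?_
      rw [Complex.ofReal_pow]
      exact Complex.conj_mul' _
  have hk1 : ∀ y, 1 ≤ ‖k y‖ := fun y => by
    obtain ⟨i, hi, hiy⟩ := hcon y
    rw [hky, Complex.norm_real, Real.norm_of_nonneg (Finset.sum_nonneg fun _ _ => sq_nonneg _)]
    exact (one_le_pow₀ hiy).trans
      (Finset.single_le_sum (f := fun i => ‖g i y‖ ^ 2) (fun _ _ => sq_nonneg _) hi)
  have hk0 : ∀ y, k y ≠ 0 := fun y h => by
    have := hk1 y
    rw [h, norm_zero] at this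
    exact absurd this (by norm_num)
  let l : Y →ᵇ ℂ := BoundedContinuousFunction.ofNormedAddCommGroup (fun y => (k y)⁻¹)
    (k.continuous.inv₀ hk0) 1 fun y => by
      rw [norm_inv]
      exact inv_le_one_of_one_le₀ (hk1 y)
  have hkl : k * l = 1 := by
    ext y
    exact mul_inv_cancel₀ (hk0 y)
  have := congrArg Φ hkl
  rw [map_mul, hk, zero_mul, map_one] at this
  exact zero_ne_one this

/-- Pull-backs along `r` of functions in `C₀(B)`, as elements of `relAlgebra r`. -/
noncomputable def pullback (r : C(Y, B)) (h : C₀(B, ℂ)) : relAlgebra r :=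
  ⟨1 * h.toBCF.compContinuous r, subset_closure (Submodule.subset_span ⟨1, h, rfl⟩)⟩

theorem pullback_apply (r : C(Y, B)) (h : C₀(B, ℂ)) (y : Y) : (pullback r h).1 y = h (r y) := by
  simp [pullback]

/-- A character of `relAlgebra r` does not vanish on all functions pulled back from `B`. -/
theorem exists_apply_pullback_ne_zero {r : C(Y, B)} (χ : RelStoneCech r) :
    ∃ h, χ (pullback r h) ≠ 0 := by
  by_contra! hcon
  obtain ⟨Φ, hΦ⟩ := exists_algHom χ
  obtain ⟨a, ha⟩ := exists_apply_eq_one χ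
  have h0 : ∀ f ∈ Submodule.span ℂ (relProducts r), Φ f = 0 := fun f hf => by
    induction hf using Submodule.span_induction with
    | mem f hf =>
      obtain ⟨φ, h, rfl⟩ := hf
      have h2 := hΦ (pullback r h)
      rw [hcon] at h2
      have h3 : Φ (h.toBCF.compContinuous r) = 0 := by
        rw [← h2]
        exact congrArg Φ (one_mul _).symm
      rw [map_mul, h3, mul_zero]
    | zero => exact map_zero _
    | add f₁ f₂ _ _ h₁ h₂ => rw [map_add, h₁, h₂, add_zero]
    | smul c f _ h => rw [map_smul, h, smul_zero]
  -- Characters of a Banach algebra are automatically continuous, so vanishing on the span passes to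
  -- its closure.
  have hcl : IsClosed {f : Y →ᵇ ℂ | Φ f = 0} :=
    isClosed_singleton.preimage (map_continuous Φ)
  have : Φ a.1 = 0 := closure_minimal h0 hcl a.2
  rw [hΦ, ha] at this
  exact one_ne_zero this

variable [T2Space B] [LocallyCompactSpace B]

/-- A basic neighbourhood of `χ` is given by finitely many `f` and radii `ε f`. The extension of `χ`
to `C_b(Y)` kills the functions `(f - χ f) / ε f`, so they have absolute value less than 1 at a
common point of `Y`. -/
theorem denseRange_unit (r : C(Y, B)) : DenseRange (relStoneCechUnit r) := by
  intro χ
  obtain ⟨Φ, hΦ⟩ := exists_algHom χ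
  rw [mem_closure_iff_nhds]
  intro N hN
  have hind : IsInducing fun (χ : RelStoneCech r) (f : relAlgebra r) => χ f :=
    (IsInducing.mk rfl : IsInducing fun (χ : WeakDual ℂ (relAlgebra r)) f => χ f).comp
      IsInducing.subtypeVal
  rw [hind.nhds_eq_comap, nhds_pi] at hN
  obtain ⟨⟨I, ε⟩, ⟨hI, hε⟩, hsub⟩ :=
    ((Filter.hasBasis_pi fun f : relAlgebra r =>
      Metric.nhds_basis_ball (x := χ f)).comap _).mem_iff.1 hN
  lift I to Finset (relAlgebra r) using hI
  obtain ⟨y, hy⟩ := exists_forall_norm_lt_one Φ I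
    (fun f => ((ε f : ℂ))⁻¹ • (f.1 - algebraMap ℂ (Y →ᵇ ℂ) (χ f))) fun f _ => by
      rw [map_smul, map_sub, hΦ, AlgHom.commutes, Algebra.algebraMap_self, RingHom.id_apply,
        sub_self, smul_zero]
  refine ⟨_, hsub fun f hf => ?_, y, rfl⟩
  rw [Metric.mem_ball, dist_eq_norm]
  have h1 : ‖((ε f : ℂ))⁻¹ * (f.1 y - χ f)‖ < 1 := by
    have := hy f hf
    rwa [BoundedContinuousFunction.smul_apply, BoundedContinuousFunction.sub_apply,
      BoundedContinuousFunction.algebraMap_apply, smul_eq_mul, smul_eq_mul, mul_one] at this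
  have h2 : 0 < ε f := hε f hf
  rwa [norm_mul, norm_inv, Complex.norm_real, Real.norm_of_nonneg h2.le, inv_mul_eq_div,
    div_lt_one h2] at h1

instance comap_nhds_neBot {r : C(Y, B)} (χ : RelStoneCech r) :
    (comap (relStoneCechUnit r) (𝓝 χ)).NeBot :=
  comap_neBot fun _ ht => (denseRange_unit r).mem_nhds ht

theorem tendsto_apply {r : C(Y, B)} (χ : RelStoneCech r) (f : relAlgebra r) :
    Tendsto f.1 (comap (relStoneCechUnit r) (𝓝 χ)) (𝓝 (χ f)) := by
  have hc : Continuous fun χ : RelStoneCech r => χ f :=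
    (WeakDual.eval_continuous f).comp continuous_subtype_val
  exact (hc.tendsto χ).comp tendsto_comap

/-- With `χ a = 1`, the function `f` equals `(f * a) / a` near `χ`. Numerator and denominator lie in
`relAlgebra r` and hence converge. -/
theorem exists_tendsto {r : C(Y, B)} (χ : RelStoneCech r) (f : Y →ᵇ ℂ) :
    ∃ c, Tendsto f (comap (relStoneCechUnit r) (𝓝 χ)) (𝓝 c) := by
  obtain ⟨a, ha⟩ := exists_apply_eq_one χ
  have h1 := tendsto_apply χ a
  have h2 := tendsto_apply χ ⟨f * a.1, mul_mem r f a.2⟩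
  rw [ha] at h1
  refine ⟨_, (h2.div h1 one_ne_zero).congr' ?_⟩
  filter_upwards [h1.eventually_ne one_ne_zero] with y hy
  exact mul_div_cancel_right₀ _ hy

theorem norm_apply_le {r : C(Y, B)} (χ : RelStoneCech r) (f : relAlgebra r) : ‖χ f‖ ≤ ‖f‖ :=
  le_of_tendsto (tendsto_apply χ f).norm (Eventually.of_forall fun y => f.1.norm_coe_le_norm y)

/-- Choose `h` in `C₀(B)` whose pull-back is not killed by `χ`. Near `χ`, the value `|h (r y)|`
stays above a positive constant, which confines `r y` to a compact set, so ultrafilter limits exist.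
Bounded functions on `B` show that these limits agree. -/
theorem exists_tendsto_anchor {r : C(Y, B)} (χ : RelStoneCech r) :
    ∃ b, Tendsto r (comap (relStoneCechUnit r) (𝓝 χ)) (𝓝 b) := by
  refine exists_tendsto_of_boundedContinuousFunction
    (fun ψ => exists_tendsto χ (ψ.compContinuous r)) fun U hU => ?_
  obtain ⟨h, hh⟩ := exists_apply_pullback_ne_zero χ
  obtain ⟨K, hK, hKs⟩ : ∃ K : Set B, IsCompact K ∧ ∀ b, ‖χ (pullback r h)‖ / 2 < ‖h b‖ → b ∈ K := by
    have hz := (zero_at_infty h).norm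
    rw [norm_zero] at hz
    have hev := hz.eventually (gt_mem_nhds (half_pos (norm_pos_iff.2 hh)))
    obtain ⟨K, hK, hKs⟩ := mem_cocompact.1 hev
    refine ⟨K, hK, fun b hb => by_contra fun hbK => ?_⟩
    exact lt_asymm hb (hKs hbK)
  have hev : ∀ᶠ y in (U : Filter Y), r y ∈ K := by
    have h1 := (tendsto_apply χ (pullback r h)).norm.eventually
      (lt_mem_nhds (half_lt_self (norm_pos_iff.2 hh)))
    filter_upwards [hU h1] with y hy
    rw [pullback_apply] at hy
    exact hKs _ hy
  obtain ⟨b, -, hb⟩ := hK.ultrafilter_le_nhds' (U.map r) hev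
  exact ⟨b, hb⟩

theorem exists_anchor (r : C(Y, B)) :
    ∃ a : C(RelStoneCech r, B), ∀ y, a (relStoneCechUnit r y) = r y := by
  obtain ⟨Φ, hΦ, h⟩ := (denseRange_unit r).exists_continuous_extension r exists_tendsto_anchor
  exact ⟨⟨Φ, hΦ⟩, h⟩

/-- The anchor map of the relative Stone–Čech compactification. -/
noncomputable def anchor (r : C(Y, B)) : C(RelStoneCech r, B) := (exists_anchor r).choose

@[simp]
theorem anchor_unit (r : C(Y, B)) (y : Y) : anchor r (relStoneCechUnit r y) = r y :=
  (exists_anchor r).choose_spec y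

theorem apply_pullback {r : C(Y, B)} (χ : RelStoneCech r) (h : C₀(B, ℂ)) :
    χ (pullback r h) = h (anchor r χ) := by
  have h1 : Continuous fun χ : RelStoneCech r => χ (pullback r h) :=
    (WeakDual.eval_continuous _).comp continuous_subtype_val
  have h2 : Continuous fun χ : RelStoneCech r => h (anchor r χ) :=
    (map_continuous h).comp (anchor r).continuous
  refine congrFun ((denseRange_unit r).equalizer h1 h2 (funext fun y => ?_)) χ
  simp [relStoneCechUnit_apply, pullback_apply]

theorem exists_zeroAtInfty_eq_one (b : B) {V : Set B} (hV : V ∈ 𝓝 b) :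
    ∃ h : C₀(B, ℂ), h b = 1 ∧ tsupport h ⊆ V := by
  obtain ⟨K, hK, hKV, hKc⟩ := local_compact_nhds hV
  obtain ⟨h, h1, h0, hc, -⟩ := exists_continuous_one_zero_of_isCompact
    (isCompact_singleton (x := b)) (isClosed_compl_iff.2 (isOpen_interior (s := K)))
    (Set.disjoint_singleton_left.2 fun hb => hb (mem_interior_iff_mem_nhds.2 hK))
  refine ⟨⟨⟨fun b => (h b : ℂ), Complex.continuous_ofReal.comp h.continuous⟩,
    (HasCompactSupport.comp_left (g := fun t : ℝ => (t : ℂ)) hc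
      Complex.ofReal_zero).is_zero_at_infty⟩, ?_, ?_⟩
  · have : h b = 1 := h1 rfl
    simp [this]
  · refine (closure_minimal (fun x hx => ?_) hKc.isClosed).trans hKV
    by_contra hxK
    refine hx ?_
    have : h x = 0 := h0 fun hi => hxK (interior_subset hi)
    simp [this]

/-- By Banach–Alaoglu, the characters together with `0` form a weak-* compact set. If the anchors
converge to `b`, the limit functional takes the value `h b = 1` at a suitable pull-back, so it is
not `0`. -/
theorem isProperMap_anchor (r : C(Y, B)) : IsProperMap (anchor r) := by
  refine isProperMap_iff_ultrafilter.2 ⟨(anchor r).continuous, fun U b hb => ?_⟩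
  have hcomp : IsCompact (WeakDual.characterSpace ℂ (relAlgebra r) ∪ {0}) := by
    refine (WeakDual.isCompact_closedBall (𝕜 := ℂ) (E := relAlgebra r) 0 1).of_isClosed_subset
      (WeakDual.CharacterSpace.union_zero_isClosed ..) ?_
    rintro χ (hχ | rfl)
    · rw [Set.mem_preimage, mem_closedBall_zero_iff]
      refine ContinuousLinearMap.opNorm_le_bound _ zero_le_one fun f => ?_
      rw [one_mul]
      exact norm_apply_le ⟨χ, hχ⟩ f
    · simp
  obtain ⟨χ, hχ, hU⟩ := hcomp.ultrafilter_le_nhds' (U.map Subtype.val)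
    (mem_map.2 (univ_mem' fun χ => Or.inl χ.2))
  have hU' : Tendsto Subtype.val (U : Filter (RelStoneCech r)) (𝓝 χ) := hU
  obtain ⟨h, h1, -⟩ := exists_zeroAtInfty_eq_one b univ_mem
  have e : χ (pullback r h) = 1 := by
    rw [← h1]
    refine tendsto_nhds_unique (((WeakDual.eval_continuous (pullback r h)).tendsto χ).comp hU') ?_
    refine (((map_continuous h).tendsto b).comp hb).congr fun χ' => ?_
    exact (apply_pullback χ' h).symm
  obtain hχ | rfl := hχ
  · refine ⟨⟨χ, hχ⟩, ?_, ?_⟩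
    · have hlim : Tendsto id (U : Filter (RelStoneCech r)) (𝓝 ⟨χ, hχ⟩) :=
        tendsto_subtype_rng.2 hU'
      exact tendsto_nhds_unique (((anchor r).continuous.tendsto _).comp hlim) hb
    · exact tendsto_subtype_rng.2 hU'
  · exact absurd e zero_ne_one

/-! ### Fibre products with étale spaces over the base, and the extension theorem -/

variable {X : Type*} [TopologicalSpace X]

/-- The map `X ×_B Y → X ×_B β_B Y`. -/
noncomputable def fibreUnit (r : C(Y, B)) (s : X → B) (p : {p : X × Y // s p.1 = r p.2}) :
    {p : X × RelStoneCech r // s p.1 = anchor r p.2} :=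
  ⟨(p.1.1, relStoneCechUnit r p.1.2), p.2.trans (anchor_unit r _).symm⟩

/-- A point of `Y` approximating `b` must also have its anchor in `s '' U`. This is an open
condition at `b` because `s` is open. -/
theorem denseRange_fibreUnit (r : C(Y, B)) {s : X → B} (hs : IsOpenMap s) :
    DenseRange (fibreUnit r s) := by
  rintro ⟨⟨γ, b⟩, h⟩
  rw [mem_closure_iff_nhds]
  intro N hN
  obtain ⟨N', hN', hsub⟩ := mem_nhds_subtype _ _ _ |>.1 hN
  obtain ⟨U, hU, W, hW, hUW⟩ := mem_nhds_prod_iff.1 hN'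
  have hV : W ∩ anchor r ⁻¹' (s '' U) ∈ 𝓝 b :=
    inter_mem hW ((anchor r).continuous.continuousAt (h ▸ hs.image_mem_nhds hU))
  obtain ⟨y, hyW, γ', hγ', e⟩ := (denseRange_unit r).mem_nhds hV
  rw [anchor_unit] at e
  exact ⟨_, hsub (hUW ⟨hγ', hyW⟩ : (γ', relStoneCechUnit r y) ∈ N'), ⟨(γ', y), e⟩, rfl⟩

/-- Functions on `X ×_B Y` that are locally, on the domain of a local section of `X → B`, given by
bounded continuous functions on the target of `φ` converge at all points of `X ×_B β_B Y`. -/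
theorem exists_tendsto_fibre (r : C(Y, B)) {s : X → B} (hs : IsLocalHomeomorph s)
    {Z : Type*} [TopologicalSpace Z] {φ : {p : X × Y // s p.1 = r p.2} → Z} (hφ : Continuous φ)
    (q : {p : X × RelStoneCech r // s p.1 = anchor r p.2}) (ψ : Z →ᵇ ℂ) :
    ∃ c, Tendsto (fun p => ψ (φ p)) (comap (fibreUnit r s) (𝓝 q)) (𝓝 c) := by
  classical
  obtain ⟨⟨γ, b⟩, hγb⟩ := q
  change s γ = anchor r b at hγb
  obtain ⟨e, hγ, rfl⟩ := hs γ
  obtain ⟨h, h1, hsupp⟩ := exists_zeroAtInfty_eq_one (e γ)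
    (e.open_target.mem_nhds (e.map_source hγ))
  -- The section of `X ×_B Y → Y` over `r ⁻¹' e.target` induced by the local section `e.symm` of `X
  -- → B`.
  let lift : {y // r y ∈ e.target} → {p : X × Y // e p.1 = r p.2} :=
    fun y => ⟨(e.symm (r y.1), y.1), e.right_inv y.2⟩
  have hlift : Continuous lift := by
    refine Continuous.subtype_mk (.prodMk ?_ continuous_subtype_val) _
    exact e.symm.continuousOn.comp_continuous (r.continuous.comp continuous_subtype_val)
      fun y => y.2
  -- The support of `h` lies in `e.target`, so extension by zero is continuous. Near `q` the
  -- function `k` is `ψ ∘ φ` times a factor tending to 1, so its convergence at `b` gives that of `ψ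
  -- ∘ φ`.
  let k : Y → ℂ := fun y => if hy : r y ∈ e.target then h (r y) * ψ (φ (lift ⟨y, hy⟩)) else 0
  have hk : Continuous k := by
    rw [continuous_iff_continuousAt]
    intro y
    by_cases hy : r y ∈ e.target
    · have ho : IsOpen {y | r y ∈ e.target} := e.open_target.preimage r.continuous
      refine ContinuousOn.continuousAt (s := {y | r y ∈ e.target}) ?_ (ho.mem_nhds hy)
      rw [continuousOn_iff_continuous_domRestrict]
      refine Continuous.congr (f := fun y : {y // r y ∈ e.target} => h (r y.1) * ψ (φ (lift y)))
        ?_ fun y => ?_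
      · exact ((map_continuous h).comp (r.continuous.comp continuous_subtype_val)).mul
          (ψ.continuous.comp (hφ.comp hlift))
      · exact (show k y.1 = _ from dif_pos y.2).symm
    · have ho : IsOpen {y | r y ∉ tsupport h} :=
        ((isClosed_tsupport _).preimage r.continuous).isOpen_compl
      refine (continuousAt_const (y := (0 : ℂ))).congr ?_
      filter_upwards [ho.mem_nhds fun hy' => hy (hsupp hy')] with z hz
      simp only [k]
      split_ifs
      · rw [image_eq_zero_of_notMem_tsupport hz, zero_mul]
      · rfl
  let k' : Y →ᵇ ℂ := BoundedContinuousFunction.ofNormedAddCommGroup k hk (‖h.toBCF‖ * ‖ψ‖)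
    fun y => by
      simp only [k]
      split_ifs
      · rw [norm_mul]
        exact mul_le_mul (h.toBCF.norm_coe_le_norm _) (ψ.norm_coe_le_norm _) (norm_nonneg _)
          (norm_nonneg _)
      · rw [norm_zero]
        positivity
  obtain ⟨c, hc⟩ := exists_tendsto b k'
  set l := comap (fibreUnit r e) (𝓝 ⟨(γ, b), hγb⟩)
  have hl : Tendsto (fibreUnit r e) l (𝓝 ⟨(γ, b), hγb⟩) := tendsto_comap
  have hl' := (continuous_subtype_val.tendsto _).comp hl
  have hl1 : Tendsto (fun p : {p : X × Y // e p.1 = r p.2} => p.1.1) l (𝓝 γ) :=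
    (continuous_fst.tendsto _).comp hl'
  have hl2 : Tendsto (fun p : {p : X × Y // e p.1 = r p.2} => p.1.2) l
      (comap (relStoneCechUnit r) (𝓝 b)) :=
    tendsto_comap_iff.2 ((continuous_snd.tendsto _).comp hl')
  have hh : Tendsto (fun p : {p : X × Y // e p.1 = r p.2} => h (e p.1.1)) l (𝓝 1) := by
    rw [← h1]
    exact (((map_continuous h).tendsto _).comp (hs.continuous.tendsto γ)).comp hl1
  refine ⟨c / 1, ((hc.comp hl2).div hh one_ne_zero).congr' ?_⟩
  filter_upwards [hh.eventually_ne one_ne_zero, hl1 (e.open_source.mem_nhds hγ)] with p hp hpe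
  have hpt : r p.1.2 ∈ e.target := p.2 ▸ e.map_source hpe
  have hpl : lift ⟨p.1.2, hpt⟩ = p := by
    refine Subtype.ext (Prod.ext ?_ rfl)
    change e.symm (r p.1.2) = p.1.1
    rw [← p.2, e.left_inv hpe]
  have : k p.1.2 = h (e p.1.1) * ψ (φ p) := by
    simp only [k, dif_pos hpt, hpl, p.2]
  change k p.1.2 / h (e p.1.1) = ψ (φ p)
  rw [this, mul_div_cancel_left₀ _ hp]

/-- The universal property of the relative Stone–Čech compactification, for fibre products with
spaces étale over the base. -/
theorem exists_extension (r : C(Y, B)) {s : X → B} (hs : IsLocalHomeomorph s)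
    {Z B' : Type*} [TopologicalSpace Z] [T2Space Z] [TopologicalSpace B']
    [LocallyCompactSpace B'] [T2Space B'] {p : Z → B'} (hp : IsProperMap p)
    {φ : {p : X × Y // s p.1 = r p.2} → Z} (hφ : Continuous φ) {f : X → B'} (hf : Continuous f)
    (hpf : ∀ x, p (φ x) = f x.1.1) :
    ∃ Φ : {p : X × RelStoneCech r // s p.1 = anchor r p.2} → Z, Continuous Φ ∧
      (∀ x, Φ (fibreUnit r s x) = φ x) ∧ ∀ x, p (Φ x) = f x.1.1 := by
  have := hp.locallyCompactSpace
  have hd := denseRange_fibreUnit r hs.isOpenMap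
  obtain ⟨Φ, hΦ, h⟩ := hd.exists_continuous_extension φ fun q => by
    have : (comap (fibreUnit r s) (𝓝 q)).NeBot := comap_neBot fun _ ht => hd.mem_nhds ht
    refine exists_tendsto_of_boundedContinuousFunction (exists_tendsto_fibre r hs hφ q)
      fun U hU => ?_
    -- Since `p ∘ φ` converges to `f q.1.1`, properness of `p` provides a limit of `φ` along the
    -- ultrafilter.
    have h1 : Tendsto (fun x : {p : X × Y // s p.1 = r p.2} => f x.1.1) U (𝓝 (f q.1.1)) :=
      ((hf.comp (continuous_fst.comp continuous_subtype_val)).tendsto q).comp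
        (tendsto_comap.mono_left hU)
    have h2 : Tendsto p (U.map φ) (𝓝 (f q.1.1)) :=
      tendsto_map'_iff.2 (h1.congr fun x => (hpf x).symm)
    obtain ⟨z, -, hz⟩ := hp.ultrafilter_le_nhds_of_tendsto h2
    exact ⟨z, hz⟩
  refine ⟨Φ, hΦ, h, fun x => congrFun (hd.equalizer (hp.continuous.comp hΦ)
    (hf.comp (continuous_fst.comp continuous_subtype_val)) (funext fun x => ?_)) x⟩
  change p (Φ (fibreUnit r s x)) = f x.1.1
  rw [h, hpf]

end RelStoneCech

/-! ## Quotients by étale equivalence relations -/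

section OpenQuotient

variable {P A B : Type*} [TopologicalSpace P] [TopologicalSpace A] [TopologicalSpace B]

theorem IsOpenMap.fst_fibreProduct {f : P → B} (hf : Continuous f) {r : A → B} (hr : IsOpenMap r) :
    IsOpenMap fun p : {p : P × A // f p.1 = r p.2} => p.1.1 := by
  rw [isOpenMap_iff_nhds_le]
  rintro ⟨⟨p, a⟩, h⟩ N hN
  obtain ⟨N', hN', hsub⟩ := mem_nhds_subtype _ _ _ |>.1 (Filter.mem_map.1 hN)
  obtain ⟨U, hU, W, hW, hUW⟩ := mem_nhds_prod_iff.1 hN'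
  change f p = r a at h
  have h1 := hf.continuousAt (h ▸ hr.image_mem_nhds hW : r '' W ∈ 𝓝 (f p))
  filter_upwards [hU, h1] with p' hp' ⟨a', ha', e⟩
  exact hsub (show (⟨(p', a'), e.symm⟩ : {p : P × A // f p.1 = r p.2}) ∈ Subtype.val ⁻¹' N' from
    hUW ⟨hp', ha'⟩)

theorem IsOpenMap.snd_fibreProduct {f : P → B} (hf : IsOpenMap f) {r : A → B} (hr : Continuous r) :
    IsOpenMap fun p : {p : P × A // f p.1 = r p.2} => p.1.2 := by
  let e : {p : P × A // f p.1 = r p.2} ≃ₜ {p : A × P // r p.1 = f p.2} :=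
    { toFun := fun p => ⟨(p.1.2, p.1.1), p.2.symm⟩
      invFun := fun p => ⟨(p.1.2, p.1.1), p.2.symm⟩
      left_inv := fun _ => rfl
      right_inv := fun _ => rfl
      continuous_toFun := by fun_prop
      continuous_invFun := by fun_prop }
  exact (IsOpenMap.fst_fibreProduct hr hf).comp e.isOpenMap

/-- The quotient map by an equivalence relation parametrised by an open map is open. -/
theorem isOpenQuotientMap_quotientMk (S : Setoid P) {f : P → B} (hf : Continuous f) {r : A → B}
    (hr : IsOpenMap r) {m : {p : P × A // f p.1 = r p.2} → P} (hm : Continuous m)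
    (hS : ∀ p q, S p q ↔ ∃ (a : A) (h : f p = r a), m ⟨(p, a), h⟩ = q) :
    IsOpenQuotientMap (Quotient.mk S) := by
  refine ⟨Quotient.mk_surjective, continuous_quotient_mk', fun N hN => ?_⟩
  -- The saturation of `N` is the image of the open set `m ⁻¹' N` under a base change of the open
  -- map `r`.
  have : Quotient.mk S ⁻¹' (Quotient.mk S '' N) =
      (fun p : {p : P × A // f p.1 = r p.2} => p.1.1) '' (m ⁻¹' N) := by
    ext p
    constructor
    · rintro ⟨q, hq, e⟩
      obtain ⟨a, h, rfl⟩ := (hS p q).1 (Quotient.exact e.symm)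
      exact ⟨_, hq, rfl⟩
    · rintro ⟨⟨⟨p, a⟩, h⟩, hq, rfl⟩
      exact ⟨_, hq, Quotient.sound (S.symm ((hS _ _).2 ⟨a, h, rfl⟩))⟩
  rw [← isQuotientMap_quotient_mk'.isOpen_preimage]
  exact this ▸ IsOpenMap.fst_fibreProduct hf hr _ (hN.preimage hm)

end OpenQuotient

theorem GrpdCorr.isOpenQuotientMap_mk {H G : EtaleGroupoid.{w}} (X : GrpdCorr H G) :
    IsOpenQuotientMap (Quotient.mk X.orbitSetoid) :=
  isOpenQuotientMap_quotientMk _ X.isLocalHomeomorph_s.continuous G.isLocalHomeomorph_r.isOpenMap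
    X.continuous_ract fun _ _ => exists₂_congr fun _ _ => eq_comm

/-! ### Diagram actions as partial maps on the whole space over `G⁰` -/

namespace CorrDiagram

variable {C : Type u} [Category.{v} C] {F : CorrDiagram.{w} C}

/-- The right anchor map of `F.X g`, as a map to `G⁰`. -/
abbrev src (F : CorrDiagram.{w} C) {x x' : C} (g : x ⟶ x') (γ : (F.X g).carrier) : F.Obj :=
  ⟨x, (F.X g).s γ⟩

/-- The left anchor map of `F.X g`, as a map to `G⁰`. -/
abbrev tgt (F : CorrDiagram.{w} C) {x x' : C} (g : x ⟶ x') (γ : (F.X g).carrier) : F.Obj :=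
  ⟨x', (F.X g).r γ⟩

theorem isLocalHomeomorph_sigmaMk (F : CorrDiagram.{w} C) (x : C) :
    IsLocalHomeomorph (fun b => ⟨x, b⟩ : (F.G x).Obj → F.Obj) :=
  (IsOpenEmbedding.sigmaMk (σ := fun x => (F.G x).Obj)).isLocalHomeomorph

theorem isLocalHomeomorph_src {x x' : C} (g : x ⟶ x') : IsLocalHomeomorph (F.src g) :=
  (F.isLocalHomeomorph_sigmaMk x).comp (F.X g).isLocalHomeomorph_s

theorem continuous_tgt {x x' : C} (g : x ⟶ x') : Continuous (F.tgt g) :=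
  continuous_sigmaMk.comp (F.X g).continuous_r

/-- The multiplication maps of an `F`-action, written as partially defined maps on the whole
space, without the conditions that they be open, surjective and injective up to the action of the
groupoids. -/
structure PreAction (F : CorrDiagram.{w} C) (Y : Type t) [TopologicalSpace Y] where
  anchor : C(Y, F.Obj)
  act : {x x' : C} → (g : x ⟶ x') → (γ : (F.X g).carrier) → (y : Y) →
    F.src g γ = anchor y → Y
  anchor_act : ∀ {x x' : C} (g : x ⟶ x') γ y e, anchor (act g γ y e) = F.tgt g γ
  continuous_act : ∀ {x x' : C} (g : x ⟶ x'),
    Continuous fun p : {p : (F.X g).carrier × Y // F.src g p.1 = anchor p.2} =>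
      act g p.1.1 p.1.2 p.2
  act_act : ∀ {x x' x'' : C} (g₂ : x ⟶ x') (g₁ : x' ⟶ x'') γ₁ γ₂ y
    (e₁ : (F.X g₁).s γ₁ = (F.X g₂).r γ₂) (e₂ : F.src g₂ γ₂ = anchor y),
    act g₁ γ₁ (act g₂ γ₂ y e₂) ((congrArg (Sigma.mk x') e₁).trans (anchor_act g₂ γ₂ y e₂).symm) =
      act (g₂ ≫ g₁) (F.μ g₂ g₁ (.mk γ₁ γ₂ e₁)) y
        ((congrArg (Sigma.mk x) (F.s_μ g₂ g₁ γ₁ γ₂ e₁)).trans e₂)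
  one_act : ∀ (x : C) (b : (F.G x).Obj) y (e : ⟨x, b⟩ = anchor y),
    act (𝟙 x) (F.ν x ((F.G x).one b)) y
      ((congrArg (Sigma.mk x) ((F.s_ν _ _).trans ((F.G x).s_one b))).trans e) = y

namespace PreAction

variable {Y Z : Type*} [TopologicalSpace Y] [TopologicalSpace Z] (T : F.PreAction Y)

theorem act_congr {x x' : C} {g g' : x ⟶ x'} (hg : g = g') {γ : (F.X g).carrier}
    {γ' : (F.X g').carrier} (hγ : hg ▸ γ = γ') (y : Y) (e : F.src g γ = T.anchor y)
    (e' : F.src g' γ' = T.anchor y) : T.act g γ y e = T.act g' γ' y e' := by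
  subst hg
  subst hγ
  rfl

/-- The action of the groupoid `F.G x`. -/
def gact {x : C} (η : (F.G x).Arr) (y : Y) (e : ⟨x, (F.G x).s η⟩ = T.anchor y) : Y :=
  T.act (𝟙 x) (F.ν x η) y ((congrArg (Sigma.mk x) (F.s_ν x η)).trans e)

theorem anchor_gact {x : C} (η : (F.G x).Arr) (y : Y) (e) :
    T.anchor (T.gact η y e) = ⟨x, (F.G x).r η⟩ :=
  (T.anchor_act ..).trans (congrArg (Sigma.mk x) (F.r_ν x η))

theorem continuous_gact (x : C) : Continuous
    fun p : {p : (F.G x).Arr × Y // (⟨x, (F.G x).s p.1⟩ : F.Obj) = T.anchor p.2} =>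
      T.gact p.1.1 p.1.2 p.2 := by
  have hf : Continuous
      fun p : {p : (F.G x).Arr × Y // (⟨x, (F.G x).s p.1⟩ : F.Obj) = T.anchor p.2} =>
        (⟨(F.ν x p.1.1, p.1.2), (congrArg (Sigma.mk x) (F.s_ν x p.1.1)).trans p.2⟩ :
          {p : (F.X (𝟙 x)).carrier × Y // F.src (𝟙 x) p.1 = T.anchor p.2}) := by
    fun_prop
  exact (T.continuous_act (𝟙 x)).comp hf

theorem gact_one {x : C} (b : (F.G x).Obj) (y : Y) (e) :
    T.gact ((F.G x).one b) y e = y :=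
  T.one_act x b y ((congrArg (Sigma.mk x) ((F.G x).s_one b)).symm.trans e)

/-- Associativity for `𝟙 x` and `g`, where `μ_unit_right` identifies the product of `γ` and `F.ν x
η` with `γ · η`. -/
theorem act_ract {x x' : C} (g : x ⟶ x') (γ : (F.X g).carrier) (η : (F.G x).Arr) (y : Y)
    (h : (F.X g).s γ = (F.G x).r η) (e : ⟨x, (F.G x).s η⟩ = T.anchor y) :
    T.act g ((F.X g).ract γ η h) y ((congrArg (Sigma.mk x) ((F.X g).s_ract γ η h)).trans e) =
      T.act g γ (T.gact η y e) ((congrArg (Sigma.mk x) h).trans (T.anchor_gact η y e).symm) := by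
  refine Eq.trans ?_ (T.act_act (𝟙 x) g γ (F.ν x η) y (h.trans (F.r_ν x η).symm) _).symm
  exact (T.act_congr (Category.id_comp g) (F.μ_unit_right g γ η h) y _ _).symm

theorem gact_mul {x : C} (η θ : (F.G x).Arr) (y : Y) (h : (F.G x).s η = (F.G x).r θ)
    (e : ⟨x, (F.G x).s θ⟩ = T.anchor y) :
    T.gact ((F.G x).mul η θ h) y ((congrArg (Sigma.mk x) ((F.G x).s_mul η θ h)).trans e) =
      T.gact η (T.gact θ y e) ((congrArg (Sigma.mk x) h).trans (T.anchor_gact θ y e).symm) := by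
  refine Eq.trans ?_ (T.act_act (𝟙 x) (𝟙 x) (F.ν x η) (F.ν x θ) y
    ((F.s_ν x η).trans (h.trans (F.r_ν x θ).symm)) _).symm
  refine (T.act_congr (Category.comp_id (𝟙 x))
    ((F.μ_unit_left (𝟙 x) (F.ν x θ) η (h.trans (F.r_ν x θ).symm)).trans
      (F.lact_ν x η θ h).symm) y _ _).symm

theorem gact_inv_gact {x : C} (η : (F.G x).Arr) (y : Y) (e : ⟨x, (F.G x).s η⟩ = T.anchor y) :
    T.gact ((F.G x).inv η) (T.gact η y e)
      ((congrArg (Sigma.mk x) ((F.G x).s_inv η)).trans (T.anchor_gact η y e).symm) = y := by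
  rw [← T.gact_mul _ _ _ ((F.G x).s_inv η)]
  simp only [(F.G x).inv_mul]
  exact T.gact_one ..

theorem gact_gact_inv {x : C} (η : (F.G x).Arr) (y : Y) (e : ⟨x, (F.G x).r η⟩ = T.anchor y) :
    T.gact η (T.gact ((F.G x).inv η) y ((congrArg (Sigma.mk x) ((F.G x).s_inv η)).trans e))
      ((congrArg (Sigma.mk x) ((F.G x).r_inv η)).symm.trans (T.anchor_gact ..).symm) = y := by
  rw [← T.gact_mul _ _ _ ((F.G x).r_inv η).symm]
  simp only [(F.G x).mul_inv]
  exact T.gact_one ..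

/-! ### Orbit spaces of the fibre products: Hausdorffness and properness -/

/-- The fibre product on which `T.act g` is defined. -/
abbrev Fibre {x x' : C} (g : x ⟶ x') : Type _ :=
  {p : (F.X g).carrier × Y // F.src g p.1 = T.anchor p.2}

/-- The relation identifying `(γ · η, y)` and `(γ, η · y)`. -/
def orbitSetoid {x x' : C} (g : x ⟶ x') : Setoid (T.Fibre g) where
  r p q := ∃ (η : (F.G x).Arr) (h₁ : (F.X g).s p.1.1 = (F.G x).r η)
    (h₂ : ⟨x, (F.G x).s η⟩ = T.anchor q.1.2),
    q.1.1 = (F.X g).ract p.1.1 η h₁ ∧ p.1.2 = T.gact η q.1.2 h₂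
  iseqv :=
    { refl := fun ⟨⟨γ, y⟩, e⟩ =>
        ⟨(F.G x).one ((F.X g).s γ), ((F.G x).r_one _).symm,
          (congrArg (Sigma.mk x) ((F.G x).s_one _)).trans e, ((F.X g).ract_one γ).symm,
          (T.gact_one ..).symm⟩
      symm := by
        rintro ⟨⟨γ, y⟩, e⟩ ⟨⟨γ', y'⟩, e'⟩ ⟨η, h₁, h₂, hγ, hy⟩
        change (F.X g).s γ = (F.G x).r η at h₁
        change (⟨x, (F.G x).s η⟩ : F.Obj) = T.anchor y' at h₂
        change γ' = (F.X g).ract γ η h₁ at hγ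
        change y = T.gact η y' h₂ at hy
        subst hγ hy
        refine ⟨(F.G x).inv η, ((F.X g).s_ract _ _ _).trans ((F.G x).r_inv η).symm,
          (congrArg (Sigma.mk x) ((F.G x).s_inv η)).trans (T.anchor_gact _ _ h₂).symm, ?_, ?_⟩
        · rw [← (F.X g).ract_mul γ η ((F.G x).inv η) h₁ ((F.G x).r_inv η).symm]
          simp only [(F.G x).mul_inv, ← h₁, (F.X g).ract_one]
        · exact (T.gact_inv_gact η y' h₂).symm
      trans := by
        rintro ⟨⟨γ, y⟩, e⟩ ⟨⟨γ', y'⟩, e'⟩ ⟨⟨γ'', y''⟩, e''⟩ ⟨η, h₁, h₂, hγ, hy⟩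
          ⟨θ, h₃, h₄, hγ', hy'⟩
        change (F.X g).s γ = (F.G x).r η at h₁
        change (⟨x, (F.G x).s η⟩ : F.Obj) = T.anchor y' at h₂
        change γ' = (F.X g).ract γ η h₁ at hγ
        change y = T.gact η y' h₂ at hy
        change (F.X g).s γ' = (F.G x).r θ at h₃
        change (⟨x, (F.G x).s θ⟩ : F.Obj) = T.anchor y'' at h₄
        change γ'' = (F.X g).ract γ' θ h₃ at hγ'
        change y' = T.gact θ y'' h₄ at hy'
        subst hγ hγ' hy' hy
        have h : (F.G x).s η = (F.G x).r θ := ((F.X g).s_ract γ η h₁).symm.trans h₃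
        exact ⟨(F.G x).mul η θ h, h₁.trans ((F.G x).r_mul _ _ _).symm,
          (congrArg (Sigma.mk x) ((F.G x).s_mul _ _ _)).trans h₄,
          ((F.X g).ract_mul γ η θ h₁ h).symm, (T.gact_mul η θ y'' h h₄).symm⟩ }

theorem src_inv_eq {x x' : C} (g : x ⟶ x')
    (p : {p : T.Fibre g × (F.G x).Arr // (F.X g).s p.1.1.1 = (F.G x).r p.2}) :
    (⟨x, (F.G x).s ((F.G x).inv p.1.2)⟩ : F.Obj) = T.anchor p.1.1.1.2 :=
  (congrArg (Sigma.mk x) (((F.G x).s_inv _).trans p.2.symm)).trans p.1.1.2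

/-- The diagonal action of the groupoid on `T.Fibre g`. -/
def translate {x x' : C} (g : x ⟶ x')
    (p : {p : T.Fibre g × (F.G x).Arr // (F.X g).s p.1.1.1 = (F.G x).r p.2}) : T.Fibre g :=
  ⟨((F.X g).ract p.1.1.1.1 p.1.2 p.2,
    T.gact ((F.G x).inv p.1.2) p.1.1.1.2 (T.src_inv_eq g p)),
    (congrArg (Sigma.mk x) (((F.X g).s_ract ..).trans ((F.G x).r_inv _).symm)).trans
      (T.anchor_gact _ _ (T.src_inv_eq g p)).symm⟩

theorem continuous_translate {x x' : C} (g : x ⟶ x') : Continuous (T.translate g) := by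
  refine Continuous.subtype_mk (.prodMk ?_ ?_) _
  · exact (F.X g).continuous_ract.comp
      (f := fun p : {p : T.Fibre g × (F.G x).Arr // (F.X g).s p.1.1.1 = (F.G x).r p.2} =>
        ⟨(p.1.1.1.1, p.1.2), p.2⟩) (by fun_prop)
  · have := (F.G x).continuous_inv
    exact (T.continuous_gact x).comp
      (f := fun p : {p : T.Fibre g × (F.G x).Arr // (F.X g).s p.1.1.1 = (F.G x).r p.2} =>
        ⟨((F.G x).inv p.1.2, p.1.1.1.2), T.src_inv_eq g p⟩) (by fun_prop)

/-- Parametrising the relation by `translate` and the open range map of `F.G x` makes the quotient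
map open. -/
theorem orbitSetoid_iff {x x' : C} (g : x ⟶ x') (p q : T.Fibre g) :
    T.orbitSetoid g p q ↔ ∃ (η : (F.G x).Arr) (h : (F.X g).s p.1.1 = (F.G x).r η),
      T.translate g ⟨(p, η), h⟩ = q := by
  constructor
  · obtain ⟨⟨γ, y⟩, e⟩ := p
    obtain ⟨⟨γ', y'⟩, e'⟩ := q
    rintro ⟨η, h₁, h₂, hγ, hy⟩
    change (F.X g).s γ = (F.G x).r η at h₁
    change (⟨x, (F.G x).s η⟩ : F.Obj) = T.anchor y' at h₂
    change γ' = (F.X g).ract γ η h₁ at hγ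
    change y = T.gact η y' h₂ at hy
    subst hγ hy
    exact ⟨η, h₁, Subtype.ext (Prod.ext rfl (T.gact_inv_gact η y' h₂))⟩
  · rintro ⟨η, h, rfl⟩
    exact ⟨η, h, (congrArg (Sigma.mk x) ((F.G x).r_inv η)).symm.trans
      (T.anchor_gact _ _ (T.src_inv_eq g ⟨(p, η), h⟩)).symm, rfl,
      (T.gact_gact_inv η p.1.2 ((congrArg (Sigma.mk x) h).symm.trans p.2)).symm⟩

theorem isOpenQuotientMap_mk {x x' : C} (g : x ⟶ x') :
    IsOpenQuotientMap (Quotient.mk (T.orbitSetoid g)) :=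
  isOpenQuotientMap_quotientMk _ (f := fun p : T.Fibre g => (F.X g).s p.1.1)
    ((F.X g).isLocalHomeomorph_s.continuous.comp
      (continuous_fst.comp continuous_subtype_val))
    (F.G x).isLocalHomeomorph_r.isOpenMap (T.continuous_translate g) (T.orbitSetoid_iff g)

/-- The orbit space of `T.Fibre g`. -/
abbrev Quot {x x' : C} (g : x ⟶ x') : Type _ := Quotient (T.orbitSetoid g)

/-- The projection from the orbit space of `T.Fibre g` to that of `F.X g`. -/
def quotFst {x x' : C} (g : x ⟶ x') : T.Quot g → (F.X g).OrbitSpace :=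
  Quotient.map (fun p => p.1.1) fun _ _ ⟨η, h, _, e, _⟩ => ⟨η, h, e⟩

theorem continuous_quotFst {x x' : C} (g : x ⟶ x') : Continuous (T.quotFst g) :=
  Continuous.quotient_map' (continuous_fst.comp continuous_subtype_val) _

open Filter

/-- It suffices that the orbit relation is closed. For convergent related pairs, the limits `γ` and
`γ'` have the same orbit because `(F.X g).OrbitSpace` is Hausdorff, say `γ' = γ · k`. Basicness
forces the arrows relating the pairs to converge to `k`, and then `y = k · y'` by continuity. -/
theorem t2Space_quot [T2Space Y] {x x' : C} (g : x ⟶ x') [T2Space (F.X g).OrbitSpace] :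
    T2Space (T.Quot g) := by
  rw [t2Space_iff_of_isOpenQuotientMap (T.isOpenQuotientMap_mk g), isClosed_iff_ultrafilter]
  rintro ⟨⟨⟨γ, y⟩, e⟩, ⟨⟨γ', y'⟩, e'⟩⟩ U hU hmem
  let R := {q : T.Fibre g × T.Fibre g // T.orbitSetoid g q.1 q.2}
  let l : Filter R := comap Subtype.val U
  have hl : Tendsto (Subtype.val : R → _) l U := tendsto_comap
  have : l.NeBot := comap_neBot_iff.2 fun t ht => by
    obtain ⟨q, hq, hq'⟩ := U.nonempty_of_mem (inter_mem ht hmem)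
    exact ⟨⟨q, Quotient.exact hq'⟩, hq⟩
  have hlim : Tendsto (Subtype.val : R → _) l (𝓝 (⟨(γ, y), e⟩, ⟨(γ', y'), e'⟩)) := hl.mono_right hU
  have h1 : Tendsto (fun q : R => q.1.1.1) l (𝓝 (γ, y)) :=
    (continuous_subtype_val.tendsto _).comp ((continuous_fst.tendsto _).comp hlim)
  have h2 : Tendsto (fun q : R => q.1.2.1) l (𝓝 (γ', y')) :=
    (continuous_subtype_val.tendsto _).comp ((continuous_snd.tendsto _).comp hlim)
  have hγ := (continuous_fst.tendsto _).comp h1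
  have hy := (continuous_snd.tendsto _).comp h1
  have hγ' := (continuous_fst.tendsto _).comp h2
  have hy' := (continuous_snd.tendsto _).comp h2
  have hmk : (Quotient.mk _ γ : (F.X g).OrbitSpace) = Quotient.mk _ γ' := by
    have hc := (F.X g).isOpenQuotientMap_mk.continuous
    refine tendsto_nhds_unique ((hc.tendsto γ).comp hγ) (((hc.tendsto γ').comp hγ').congr ?_)
    rintro ⟨⟨p, q⟩, η, h, -, e, -⟩
    exact (Quotient.sound ⟨η, h, e⟩ : Quotient.mk (F.X g).orbitSetoid p.1.1 = _).symm
  obtain ⟨k, hk, rfl⟩ := Quotient.exact hmk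
  choose η h₁ h₂ hr hg using fun q : R => q.2
  -- The embedding `(γ, η) ↦ (γ, γ · η)` reflects convergence.
  have hη : Tendsto η l (𝓝 k) := by
    have : Tendsto (fun q : R => (⟨(q.1.1.1.1, η q), h₁ q⟩ :
        {p : (F.X g).carrier × (F.G x).Arr // (F.X g).s p.1 = (F.G x).r p.2})) l
        (𝓝 ⟨(γ, k), hk⟩) := by
      rw [(F.X g).basic.tendsto_nhds_iff]
      refine (hγ.prodMk_nhds hγ').congr fun q => ?_
      exact Prod.ext rfl (hr q)
    exact (continuous_snd.tendsto _).comp ((continuous_subtype_val.tendsto _).comp this)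
  have hk' : (⟨x, (F.G x).s k⟩ : F.Obj) = T.anchor y' :=
    (congrArg (Sigma.mk x) ((F.X g).s_ract γ k hk)).symm.trans e'
  refine Quotient.sound ⟨k, hk, hk', rfl, ?_⟩
  have hlim' : Tendsto (fun q : R => (⟨(η q, q.1.2.1.2), h₂ q⟩ :
      {p : (F.G x).Arr × Y // (⟨x, (F.G x).s p.1⟩ : F.Obj) = T.anchor p.2})) l
      (𝓝 ⟨(k, y'), hk'⟩) :=
    tendsto_subtype_rng.2 (hη.prodMk_nhds hy')
  exact tendsto_nhds_unique hy ((((T.continuous_gact x).tendsto _).comp hlim').congr fun q =>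
    (hg q).symm)

/-- The map from the orbit space of `T.Fibre g` to the object space induced by the left anchor map
of `F.X g`. -/
def quotAnchor {x x' : C} (g : x ⟶ x') : T.Quot g → (F.G x').Obj :=
  (F.X g).rStar ∘ T.quotFst g

/-- Lift an ultrafilter on the orbit space to `T.Fibre g` so that the first coordinates converge to
a given `γ`. Then the anchors of the second coordinates converge, and properness of `T.anchor`
supplies a limit for these coordinates. -/
theorem isProperMap_quotFst (hT : IsProperMap T.anchor) {x x' : C} (g : x ⟶ x') :
    IsProperMap (T.quotFst g) := by
  refine isProperMap_iff_ultrafilter.2 ⟨T.continuous_quotFst g, fun U c hc => ?_⟩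
  obtain ⟨γ, rfl⟩ := Quotient.mk_surjective c
  -- The orbit map of `F.X g` is open, so orbits near that of `γ` meet any neighbourhood of `γ`, and
  -- a representative can be translated into it.
  have : (comap (Quotient.mk (T.orbitSetoid g)) U ⊓
      comap (fun p : T.Fibre g => p.1.1) (𝓝 γ)).NeBot := by
    rw [inf_neBot_iff]
    rintro _ ⟨A, hA, hA'⟩ _ ⟨N, hN, hN'⟩
    obtain ⟨z, hzA, γ₁, hγ₁, hz⟩ := U.nonempty_of_mem
      (inter_mem hA (hc ((F.X g).isOpenQuotientMap_mk.isOpenMap.image_mem_nhds hN)))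
    obtain ⟨p, rfl⟩ := Quotient.mk_surjective z
    obtain ⟨η, h, rfl⟩ := Quotient.exact hz.symm
    have hq := T.isOpenQuotientMap_mk g
    have hs : Quotient.mk (T.orbitSetoid g) p = Quotient.mk _ (T.translate g ⟨(p, η), h⟩) :=
      Quotient.sound ((T.orbitSetoid_iff g _ _).2 ⟨η, h, rfl⟩)
    exact ⟨T.translate g ⟨(p, η), h⟩, hA' (show Quotient.mk _ _ ∈ A from hs ▸ hzA), hN' hγ₁⟩
  obtain ⟨V, hV⟩ := Ultrafilter.exists_le (comap (Quotient.mk (T.orbitSetoid g)) U ⊓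
      comap (fun p : T.Fibre g => p.1.1) (𝓝 γ))
  have hVU : V.map (Quotient.mk (T.orbitSetoid g)) = U :=
    Ultrafilter.coe_le_coe.1 (map_le_iff_le_comap.2 (hV.trans inf_le_left))
  have hVγ : Tendsto (fun p : T.Fibre g => p.1.1) V (𝓝 γ) :=
    map_le_iff_le_comap.2 (hV.trans inf_le_right)
  have h1 : Tendsto T.anchor (V.map fun p => p.1.2) (𝓝 (F.src g γ)) :=
    tendsto_map'_iff.2 ((((isLocalHomeomorph_src g).continuous.tendsto γ).comp hVγ).congr
      fun p => p.2)
  obtain ⟨y, hy, hVy⟩ := hT.ultrafilter_le_nhds_of_tendsto h1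
  have hlim : Tendsto id (V : Filter (T.Fibre g)) (𝓝 ⟨(γ, y), hy.symm⟩) :=
    tendsto_subtype_rng.2 (hVγ.prodMk_nhds hVy)
  refine ⟨Quotient.mk _ ⟨(γ, y), hy.symm⟩, rfl, ?_⟩
  rw [← hVU]
  exact ((T.isOpenQuotientMap_mk g).continuous.tendsto _).comp hlim

theorem isProperMap_quotAnchor (hT : IsProperMap T.anchor) {x x' : C} (g : x ⟶ x')
    (hg : (F.X g).IsProper) : IsProperMap (T.quotAnchor g) :=
  IsProperMap.comp hg (T.isProperMap_quotFst hT g)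

end PreAction

/-! ### Extending the multiplication to the relative Stone–Čech compactification -/

namespace PreAction

variable {Y : Type t} {Z : Type*} [TopologicalSpace Y] [TopologicalSpace Z]

/-- Equivariance of a continuous map. -/
structure IsEquivariant (T : F.PreAction Y) (S : F.PreAction Z) (φ : C(Y, Z)) : Prop where
  anchor_map : ∀ y, S.anchor (φ y) = T.anchor y
  act_map : ∀ {x x' : C} (g : x ⟶ x') γ y (e : F.src g γ = T.anchor y),
    φ (T.act g γ y e) = S.act g γ (φ y) (e.trans (anchor_map y).symm)

theorem IsEquivariant.gact_map {T : F.PreAction Y} {S : F.PreAction Z} {φ : C(Y, Z)}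
    (hφ : T.IsEquivariant S φ) {x : C} (η : (F.G x).Arr) (y : Y)
    (e : ⟨x, (F.G x).s η⟩ = T.anchor y) :
    φ (T.gact η y e) = S.gact η (φ y) (e.trans (hφ.anchor_map y).symm) :=
  hφ.act_map ..

/-- The conditions that turn the data of `PreAction` into an action. -/
structure IsAction (T : F.PreAction Y) : Prop where
  isOpenMap_act : ∀ {x x' : C} (g : x ⟶ x'),
    IsOpenMap fun p : T.Fibre g => T.act g p.1.1 p.1.2 p.2
  surjective_act : ∀ {x x' : C} (g : x ⟶ x') (z : Y), (T.anchor z).1 = x' →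
    ∃ γ y e, T.act g γ y e = z
  mk_eq_of_act_eq : ∀ {x x' : C} (g : x ⟶ x') (p q : T.Fibre g),
    T.act g p.1.1 p.1.2 p.2 = T.act g q.1.1 q.1.2 q.2 → T.orbitSetoid g p q

/-- The part of `Y` over the objects of `F.G x`. -/
abbrev Part (T : F.PreAction Y) (x : C) : Type _ :=
  {p : (F.G x).Obj × Y // (⟨x, p.1⟩ : F.Obj) = T.anchor p.2}

/-- The multiplication map with its image in the relevant part of `Y`. -/
def actPart (T : F.PreAction Y) {x x' : C} (g : x ⟶ x') (p : T.Fibre g) : T.Part x' :=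
  ⟨((F.X g).r p.1.1, T.act g p.1.1 p.1.2 p.2), (T.anchor_act ..).symm⟩

theorem continuous_actPart (T : F.PreAction Y) {x x' : C} (g : x ⟶ x') :
    Continuous (T.actPart g) :=
  Continuous.subtype_mk (((F.X g).continuous_r.comp
    (continuous_fst.comp continuous_subtype_val)).prodMk (T.continuous_act g)) _

theorem part_ext (T : F.PreAction Y) {x : C} {p q : T.Part x} (h : p.1.2 = q.1.2) : p = q := by
  refine Subtype.ext (Prod.ext ?_ h)
  have : (⟨x, p.1.1⟩ : F.Obj) = ⟨x, q.1.1⟩ := p.2.trans ((congrArg T.anchor h).trans q.2.symm)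
  exact sigma_mk_injective (β := fun x => (F.G x).Obj) this

theorem isOpenMap_part_snd (T : F.PreAction Y) (x : C) : IsOpenMap fun p : T.Part x => p.1.2 :=
  IsOpenMap.snd_fibreProduct (F.isLocalHomeomorph_sigmaMk x).isOpenMap T.anchor.continuous

/-- The quotient property allows continuity of a map out of `T.Part x'` to be tested after composing
with multiplication. -/
theorem IsAction.isOpenQuotientMap_actPart {T : F.PreAction Y} (hT : T.IsAction) {x x' : C}
    (g : x ⟶ x') : IsOpenQuotientMap (T.actPart g) := by
  refine ⟨fun ⟨⟨b, y⟩, e⟩ => ?_, T.continuous_actPart g, fun N hN => ?_⟩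
  · obtain ⟨γ, y', e', h⟩ := hT.surjective_act g y (congrArg Sigma.fst e).symm
    exact ⟨⟨(γ, y'), e'⟩, T.part_ext h⟩
  · have : T.actPart g '' N = (fun p : T.Part x' => p.1.2) ⁻¹'
        ((fun p : T.Fibre g => T.act g p.1.1 p.1.2 p.2) '' N) := by
      ext z
      constructor
      · rintro ⟨p, hp, rfl⟩
        exact ⟨p, hp, rfl⟩
      · rintro ⟨p, hp, h⟩
        exact ⟨p, hp, T.part_ext h⟩
    rw [this]
    exact (hT.isOpenMap_act g _ hN).preimage (continuous_snd.comp continuous_subtype_val)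

/-- Multiplication maps the orbit space of `T.Fibre g` to the underlying space. -/
def quotAct (T : F.PreAction Y) {x x' : C} (g : x ⟶ x') :
    T.Quot g → T.Part x' :=
  Quotient.lift (T.actPart g) fun p q ⟨η, h₁, h₂, hγ, hy⟩ => T.part_ext <| by
    obtain ⟨⟨γ, y⟩, e⟩ := p
    obtain ⟨⟨γ', y'⟩, e'⟩ := q
    change (F.X g).s γ = (F.G x).r η at h₁
    change (⟨x, (F.G x).s η⟩ : F.Obj) = T.anchor y' at h₂
    change γ' = (F.X g).ract γ η h₁ at hγ
    change y = T.gact η y' h₂ at hy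
    subst hγ hy
    exact (T.act_ract g γ η y' h₁ h₂).symm

theorem continuous_quotAct (T : F.PreAction Y) {x x' : C} (g : x ⟶ x') :
    Continuous (T.quotAct g) :=
  (T.continuous_actPart g).quotient_lift _

variable [F.IsLocallyCompact]

/-- Extensions of the multiplication maps to the relative Stone–Čech compactification. -/
theorem exists_betaAct (T : F.PreAction Y) {x x' : C} (g : x ⟶ x') :
    ∃ Φ : {p : (F.X g).carrier × RelStoneCech T.anchor //
        F.src g p.1 = RelStoneCech.anchor T.anchor p.2} → RelStoneCech T.anchor, Continuous Φ ∧
      (∀ p : T.Fibre g, Φ (RelStoneCech.fibreUnit T.anchor (F.src g) p) =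
        relStoneCechUnit T.anchor (T.act g p.1.1 p.1.2 p.2)) ∧
      ∀ p, RelStoneCech.anchor T.anchor (Φ p) = F.tgt g p.1.1 :=
  RelStoneCech.exists_extension T.anchor (isLocalHomeomorph_src g)
    (RelStoneCech.isProperMap_anchor T.anchor)
    ((relStoneCechUnit T.anchor).continuous.comp (T.continuous_act g)) (continuous_tgt g)
    fun _ => (RelStoneCech.anchor_unit T.anchor _).trans (T.anchor_act ..)

/-- The multiplication maps on the relative Stone–Čech compactification. -/
noncomputable def betaAct (T : F.PreAction Y) {x x' : C} (g : x ⟶ x') (γ : (F.X g).carrier)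
    (b : RelStoneCech T.anchor) (e : F.src g γ = RelStoneCech.anchor T.anchor b) :
    RelStoneCech T.anchor :=
  (T.exists_betaAct g).choose ⟨(γ, b), e⟩

theorem continuous_betaAct (T : F.PreAction Y) {x x' : C} (g : x ⟶ x') :
    Continuous fun p : {p : (F.X g).carrier × RelStoneCech T.anchor //
      F.src g p.1 = RelStoneCech.anchor T.anchor p.2} => T.betaAct g p.1.1 p.1.2 p.2 :=
  (T.exists_betaAct g).choose_spec.1

theorem betaAct_unit (T : F.PreAction Y) {x x' : C} (g : x ⟶ x') (γ : (F.X g).carrier) (y : Y)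
    (e : F.src g γ = T.anchor y) (e' : F.src g γ =
      RelStoneCech.anchor T.anchor (relStoneCechUnit T.anchor y)) :
    T.betaAct g γ (relStoneCechUnit T.anchor y) e' =
      relStoneCechUnit T.anchor (T.act g γ y e) :=
  (T.exists_betaAct g).choose_spec.2.1 ⟨(γ, y), e⟩

theorem anchor_betaAct (T : F.PreAction Y) {x x' : C} (g : x ⟶ x') (γ : (F.X g).carrier)
    (b : RelStoneCech T.anchor) (e : F.src g γ = RelStoneCech.anchor T.anchor b) :
    RelStoneCech.anchor T.anchor (T.betaAct g γ b e) = F.tgt g γ :=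
  (T.exists_betaAct g).choose_spec.2.2 ⟨(γ, b), e⟩

theorem betaAct_congr (T : F.PreAction Y) {x x' : C} (g : x ⟶ x') (γ : (F.X g).carrier)
    {b b' : RelStoneCech T.anchor} (hb : b = b') (e : F.src g γ = RelStoneCech.anchor T.anchor b)
    (e' : F.src g γ = RelStoneCech.anchor T.anchor b') :
    T.betaAct g γ b e = T.betaAct g γ b' e' := by
  subst hb
  rfl

/-- Both sides are continuous on the triple fibre product and agree on the image of the one with
`Y`. That image is dense because the source map of the fibre product of `F.X g₁` and `F.X g₂` is
open. -/
theorem betaAct_betaAct (T : F.PreAction Y) {x x' x'' : C} (g₂ : x ⟶ x') (g₁ : x' ⟶ x'')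
    (γ₁ : (F.X g₁).carrier) (γ₂ : (F.X g₂).carrier) (b : RelStoneCech T.anchor)
    (e₁ : (F.X g₁).s γ₁ = (F.X g₂).r γ₂) (e₂ : F.src g₂ γ₂ = RelStoneCech.anchor T.anchor b) :
    T.betaAct g₁ γ₁ (T.betaAct g₂ γ₂ b e₂)
        ((congrArg (Sigma.mk x') e₁).trans (T.anchor_betaAct g₂ γ₂ b e₂).symm) =
      T.betaAct (g₂ ≫ g₁) (F.μ g₂ g₁ (.mk γ₁ γ₂ e₁)) b
        ((congrArg (Sigma.mk x) (F.s_μ g₂ g₁ γ₁ γ₂ e₁)).trans e₂) := by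
  let X := {p : (F.X g₁).carrier × (F.X g₂).carrier // (F.X g₁).s p.1 = (F.X g₂).r p.2}
  let s : X → F.Obj := fun p => F.src g₂ p.1.2
  have hs : IsOpenMap s := (isLocalHomeomorph_src g₂).isOpenMap.comp
    (IsOpenMap.snd_fibreProduct (F.X g₁).isLocalHomeomorph_s.isOpenMap (F.X g₂).continuous_r)
  let W := {p : X × RelStoneCech T.anchor // s p.1 = RelStoneCech.anchor T.anchor p.2}
  have p₁ : Continuous fun p : W => p.1.1.1.1 := continuous_fst.comp
    (continuous_subtype_val.comp (continuous_fst.comp continuous_subtype_val))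
  have p₂ : Continuous fun p : W => p.1.1.1.2 := continuous_snd.comp
    (continuous_subtype_val.comp (continuous_fst.comp continuous_subtype_val))
  have p₃ : Continuous fun p : W => p.1.2 := continuous_snd.comp continuous_subtype_val
  have c1 : Continuous fun p : W => T.betaAct g₂ p.1.1.1.2 p.1.2 p.2 := by
    have hf : Continuous fun p : W => (⟨(p.1.1.1.2, p.1.2), p.2⟩ :
        {p : (F.X g₂).carrier × RelStoneCech T.anchor //
          F.src g₂ p.1 = RelStoneCech.anchor T.anchor p.2}) :=
      Continuous.subtype_mk (p₂.prodMk p₃) _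
    exact (T.continuous_betaAct g₂).comp hf
  have c2 : Continuous fun p : W => T.betaAct g₁ p.1.1.1.1 (T.betaAct g₂ p.1.1.1.2 p.1.2 p.2)
      ((congrArg (Sigma.mk x') p.1.1.2).trans (T.anchor_betaAct g₂ _ _ p.2).symm) := by
    have hf : Continuous fun p : W => (⟨(p.1.1.1.1, T.betaAct g₂ p.1.1.1.2 p.1.2 p.2),
        (congrArg (Sigma.mk x') p.1.1.2).trans (T.anchor_betaAct g₂ _ _ p.2).symm⟩ :
        {p : (F.X g₁).carrier × RelStoneCech T.anchor //
          F.src g₁ p.1 = RelStoneCech.anchor T.anchor p.2}) :=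
      Continuous.subtype_mk (p₁.prodMk c1) _
    exact (T.continuous_betaAct g₁).comp hf
  have c3 : Continuous fun p : W => T.betaAct (g₂ ≫ g₁) (F.μ g₂ g₁ (.mk p.1.1.1.1 p.1.1.1.2 p.1.1.2))
      p.1.2 ((congrArg (Sigma.mk x) (F.s_μ g₂ g₁ _ _ p.1.1.2)).trans p.2) := by
    have hm : Continuous fun p : W => F.μ g₂ g₁ (.mk p.1.1.1.1 p.1.1.1.2 p.1.1.2) :=
      (F.μ g₂ g₁).continuous.comp (continuous_quotient_mk'.comp
        (continuous_fst.comp continuous_subtype_val))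
    have hf : Continuous fun p : W => (⟨(F.μ g₂ g₁ (.mk p.1.1.1.1 p.1.1.1.2 p.1.1.2), p.1.2),
        (congrArg (Sigma.mk x) (F.s_μ g₂ g₁ _ _ p.1.1.2)).trans p.2⟩ :
        {p : (F.X (g₂ ≫ g₁)).carrier × RelStoneCech T.anchor //
          F.src (g₂ ≫ g₁) p.1 = RelStoneCech.anchor T.anchor p.2}) :=
      Continuous.subtype_mk (hm.prodMk p₃) _
    exact (T.continuous_betaAct (g₂ ≫ g₁)).comp hf
  refine congrFun ((RelStoneCech.denseRange_fibreUnit T.anchor hs).equalizer c2 c3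
    (funext fun p => ?_)) (⟨(⟨(γ₁, γ₂), e₁⟩, b), e₂⟩ : W)
  obtain ⟨⟨⟨⟨δ₁, δ₂⟩, d₁⟩, y⟩, d₂⟩ := p
  change F.src g₂ δ₂ = T.anchor y at d₂
  have h₁ := (congrArg (Sigma.mk x') d₁).trans (T.anchor_act g₂ δ₂ y d₂).symm
  have h₂ := (congrArg (Sigma.mk x) (F.s_μ g₂ g₁ _ _ d₁)).trans d₂
  refine (T.betaAct_congr g₁ δ₁ (T.betaAct_unit g₂ δ₂ y d₂ _) _
    (h₁.trans (RelStoneCech.anchor_unit T.anchor _).symm)).trans ?_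
  refine (T.betaAct_unit g₁ δ₁ _ h₁ _).trans (.trans ?_ (T.betaAct_unit (g₂ ≫ g₁) _ y h₂ _).symm)
  exact congrArg _ (T.act_act g₂ g₁ δ₁ δ₂ y d₁ d₂)

theorem one_betaAct (T : F.PreAction Y) (x : C) (b : (F.G x).Obj) (z : RelStoneCech T.anchor)
    (e : ⟨x, b⟩ = RelStoneCech.anchor T.anchor z) :
    T.betaAct (𝟙 x) (F.ν x ((F.G x).one b)) z
      ((congrArg (Sigma.mk x) ((F.s_ν _ _).trans ((F.G x).s_one b))).trans e) = z := by
  let W := {p : (F.G x).Obj × RelStoneCech T.anchor //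
    (⟨x, p.1⟩ : F.Obj) = RelStoneCech.anchor T.anchor p.2}
  have c1 : Continuous fun p : W => T.betaAct (𝟙 x) (F.ν x ((F.G x).one p.1.1)) p.1.2
      ((congrArg (Sigma.mk x) ((F.s_ν _ _).trans ((F.G x).s_one _))).trans p.2) := by
    have := (F.G x).continuous_one
    have hf : Continuous fun p : W => (⟨(F.ν x ((F.G x).one p.1.1), p.1.2),
        (congrArg (Sigma.mk x) ((F.s_ν _ _).trans ((F.G x).s_one _))).trans p.2⟩ :
        {p : (F.X (𝟙 x)).carrier × RelStoneCech T.anchor //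
          F.src (𝟙 x) p.1 = RelStoneCech.anchor T.anchor p.2}) := by fun_prop
    exact (T.continuous_betaAct (𝟙 x)).comp hf
  refine congrFun ((RelStoneCech.denseRange_fibreUnit T.anchor
    (F.isLocalHomeomorph_sigmaMk x).isOpenMap).equalizer c1
    (continuous_snd.comp continuous_subtype_val) (funext fun p => ?_)) (⟨(b, z), e⟩ : W)
  obtain ⟨⟨b, y⟩, d⟩ := p
  change (⟨x, b⟩ : F.Obj) = T.anchor y at d
  refine (T.betaAct_unit (𝟙 x) (F.ν x ((F.G x).one b)) y
    ((congrArg (Sigma.mk x) ((F.s_ν _ _).trans ((F.G x).s_one b))).trans d) _).trans ?_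
  exact congrArg _ (T.one_act x b y d)

/-- The induced multiplication maps on the relative Stone–Čech compactification. -/
noncomputable def beta (T : F.PreAction Y) : F.PreAction (RelStoneCech T.anchor) where
  anchor := RelStoneCech.anchor T.anchor
  act := T.betaAct
  anchor_act := T.anchor_betaAct
  continuous_act := T.continuous_betaAct
  act_act := T.betaAct_betaAct
  one_act := T.one_betaAct

theorem isEquivariant_unit (T : F.PreAction Y) :
    T.IsEquivariant T.beta (relStoneCechUnit T.anchor) where
  anchor_map := RelStoneCech.anchor_unit T.anchor
  act_map g γ y e := (T.betaAct_unit g γ y e _).symm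

/-- An equivariant map on the relative Stone–Čech compactification is determined by its values on
the given space. -/
theorem isEquivariant_of_unit {T : F.PreAction Y} {S : F.PreAction Z} [T2Space Z]
    {T' : F.PreAction (RelStoneCech T.anchor)}
    (hT' : T.IsEquivariant T' (relStoneCechUnit T.anchor)) {φ : C(Y, Z)}
    (hφ : T.IsEquivariant S φ) {Φ : C(RelStoneCech T.anchor, Z)}
    (hΦ : ∀ y, Φ (relStoneCechUnit T.anchor y) = φ y) : T'.IsEquivariant S Φ := by
  have hd := RelStoneCech.denseRange_unit T.anchor
  -- By density, the anchor map of any structure that makes the unit equivariant is the canonical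
  -- one, so both actions live on the same fibre products.
  have h1 : ∀ b, T'.anchor b = RelStoneCech.anchor T.anchor b := congrFun <|
    hd.equalizer T'.anchor.continuous (RelStoneCech.anchor T.anchor).continuous <|
      funext fun y => (hT'.anchor_map y).trans (RelStoneCech.anchor_unit T.anchor y).symm
  have h2 : ∀ b, S.anchor (Φ b) = T'.anchor b := congrFun <|
    hd.equalizer (S.anchor.continuous.comp Φ.continuous) T'.anchor.continuous <|
      funext fun y => by
        simp only [Function.comp_apply, hΦ, hφ.anchor_map, hT'.anchor_map]
  refine ⟨h2, fun {x x'} g γ b e => ?_⟩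
  let W := {p : (F.X g).carrier × RelStoneCech T.anchor //
    F.src g p.1 = RelStoneCech.anchor T.anchor p.2}
  have c1 : Continuous fun p : W => Φ (T'.act g p.1.1 p.1.2 (p.2.trans (h1 _).symm)) := by
    have hf : Continuous fun p : W => (⟨p.1, p.2.trans (h1 _).symm⟩ : T'.Fibre g) := by fun_prop
    exact Φ.continuous.comp ((T'.continuous_act g).comp hf)
  have c2 : Continuous fun p : W =>
      S.act g p.1.1 (Φ p.1.2) ((p.2.trans (h1 _).symm).trans (h2 _).symm) := by
    have hf : Continuous fun p : W => (⟨(p.1.1, Φ p.1.2),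
      (p.2.trans (h1 _).symm).trans (h2 _).symm⟩ : S.Fibre g) := by fun_prop
    exact (S.continuous_act g).comp hf
  refine congrFun ((RelStoneCech.denseRange_fibreUnit T.anchor
    (isLocalHomeomorph_src g).isOpenMap).equalizer c1 c2
    (funext fun p => ?_)) (⟨(γ, b), e.trans (h1 _)⟩ : W)
  obtain ⟨⟨δ, y⟩, d⟩ := p
  change F.src g δ = T.anchor y at d
  change Φ (T'.act g δ (relStoneCechUnit T.anchor y) _) =
    S.act g δ (Φ (relStoneCechUnit T.anchor y)) _
  rw [← hT'.act_map g δ y d]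
  simp only [hΦ]
  exact hφ.act_map g δ y d

/-- Equivariant maps to Hausdorff spaces proper over `G⁰` extend to the relative Stone–Čech
compactification. -/
theorem exists_extension (T : F.PreAction Y) {S : F.PreAction Z} [T2Space Z]
    (hS : IsProperMap S.anchor) {φ : C(Y, Z)} (hφ : T.IsEquivariant S φ) :
    ∃ Φ : C(RelStoneCech T.anchor, Z), ∀ y, Φ (relStoneCechUnit T.anchor y) = φ y := by
  -- With the identity of `G⁰` as étale map, the fibre product is the graph of the anchor map, that
  -- is, a copy of the space itself.
  obtain ⟨Ψ, hΨ, h, -⟩ := RelStoneCech.exists_extension T.anchor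
    (s := (id : F.Obj → F.Obj)) (Homeomorph.refl _).isLocalHomeomorph hS
    (φ := fun p => φ p.1.2) (by fun_prop) continuous_id fun p => (hφ.anchor_map _).trans p.2.symm
  refine ⟨⟨fun b => Ψ ⟨(RelStoneCech.anchor T.anchor b, b), rfl⟩, hΨ.comp (by fun_prop)⟩,
    fun y => ?_⟩
  refine Eq.trans (congrArg Ψ ?_) (h ⟨(T.anchor y, y), rfl⟩)
  exact Subtype.ext (Prod.ext (RelStoneCech.anchor_unit T.anchor y) rfl)

/-- The inverse of the multiplication map on the relative Stone–Čech compactification. -/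
theorem exists_inverse_quotAct (hF : F.IsProper) {T : F.PreAction Y} (hT : T.IsAction) {x x' : C}
    (g : x ⟶ x') : ∃ Φ : T.beta.Part x' → T.beta.Quot g, Continuous Φ ∧
      (∀ z, T.beta.quotAct g (Φ z) = z) ∧ ∀ p, Φ (T.beta.actPart g p) = Quotient.mk _ p := by
  have := (inferInstance : F.IsLocallyCompact).orbitSpace_t2 g
  have := ((inferInstance : F.IsLocallyCompact).groupoid x').t2
  have := ((inferInstance : F.IsLocallyCompact).groupoid x').locallyCompact
  have hT2 : T2Space (T.beta.Quot g) := T.beta.t2Space_quot g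
  have hp := T.beta.isProperMap_quotAnchor (RelStoneCech.isProperMap_anchor T.anchor) g (hF _ _ g)
  have hq := hT.isOpenQuotientMap_actPart g
  let i : T.Fibre g → T.beta.Fibre g := RelStoneCech.fibreUnit T.anchor (F.src g)
  have hi : Continuous i := Continuous.subtype_mk (by fun_prop) _
  -- Choose a factorisation of `z` as a product and take its orbit in the compactified fibre
  -- product. By condition (2) for `Y`, the orbit does not depend on the choice.
  let φ : T.Part x' → T.beta.Quot g := fun z =>
    Quotient.mk _ (i (Function.surjInv hq.surjective z))
  have hφ : ∀ p, φ (T.actPart g p) = Quotient.mk _ (i p) := fun p => by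
    obtain ⟨η, h₁, h₂, hγ, hy⟩ := hT.mk_eq_of_act_eq g _ _ (congrArg (fun z => z.1.2)
      (Function.surjInv_eq hq.surjective (T.actPart g p)))
    refine Quotient.sound ⟨η, h₁, h₂.trans (T.isEquivariant_unit.anchor_map _).symm, hγ, ?_⟩
    exact (congrArg _ hy).trans (T.isEquivariant_unit.gact_map η _ h₂)
  have hφc : Continuous φ := hq.continuous_comp_iff.1 <|
    (continuous_quotient_mk'.comp hi).congr fun p => (hφ p).symm
  -- Here the étale space is the summand of `G⁰` at `x'`. The target `T.beta.Quot g` is Hausdorff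
  -- and proper over it, which is where properness of the diagram enters.
  obtain ⟨Φ, hΦ, h, -⟩ := RelStoneCech.exists_extension T.anchor (F.isLocalHomeomorph_sigmaMk x')
    hp hφc continuous_id fun z => by
      obtain ⟨p, rfl⟩ := hq.surjective z
      rw [hφ]
      rfl
  refine ⟨Φ, hΦ, congrFun ((RelStoneCech.denseRange_fibreUnit T.anchor
    (F.isLocalHomeomorph_sigmaMk x').isOpenMap).equalizer
      ((T.beta.continuous_quotAct g).comp hΦ) continuous_id (funext fun z => ?_)),
    congrFun ((RelStoneCech.denseRange_fibreUnit T.anchor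
    (isLocalHomeomorph_src g).isOpenMap).equalizer
      (hΦ.comp (T.beta.continuous_actPart g)) continuous_quotient_mk' (funext fun p => ?_))⟩
  · obtain ⟨p, rfl⟩ := hq.surjective z
    refine (congrArg (T.beta.quotAct g) ((h _).trans (hφ p))).trans ?_
    exact T.beta.part_ext (T.isEquivariant_unit.act_map g _ _ p.2).symm
  · refine Eq.trans (congrArg Φ ?_) ((h (T.actPart g p)).trans (hφ p))
    exact T.beta.part_ext (T.isEquivariant_unit.act_map g _ _ p.2).symm

/-- Multiplication is the open orbit map, followed by a homeomorphism onto the part over `x'` and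
the open projection of that part to the whole space. Surjectivity of the homeomorphism gives
surjectivity of multiplication, and injectivity gives condition (2). -/
theorem isAction_beta (hF : F.IsProper) {T : F.PreAction Y} (hT : T.IsAction) :
    T.beta.IsAction where
  isOpenMap_act {x x'} g N hN := by
    obtain ⟨Φ, hΦ, h1, h2⟩ := exists_inverse_quotAct hF hT g
    have : (fun p : T.beta.Fibre g => T.beta.act g p.1.1 p.1.2 p.2) '' N =
        (fun z : T.beta.Part x' => z.1.2) '' (Φ ⁻¹' (Quotient.mk _ '' N)) := by
      ext z
      constructor
      · rintro ⟨p, hp, rfl⟩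
        exact ⟨T.beta.actPart g p, ⟨p, hp, (h2 p).symm⟩, rfl⟩
      · rintro ⟨z, ⟨p, hp, e⟩, rfl⟩
        refine ⟨p, hp, ?_⟩
        rw [← h1 z, ← e]
        rfl
    rw [this]
    exact T.beta.isOpenMap_part_snd x' _
      (((T.beta.isOpenQuotientMap_mk g).isOpenMap _ hN).preimage hΦ)
  surjective_act {x x'} g z hz := by
    obtain ⟨Φ, -, h1, -⟩ := exists_inverse_quotAct hF hT g
    subst hz
    let z' : T.beta.Part (T.beta.anchor z).1 := ⟨((T.beta.anchor z).2, z), rfl⟩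
    obtain ⟨p, hp⟩ := Quotient.mk_surjective (Φ z')
    refine ⟨p.1.1, p.1.2, p.2, ?_⟩
    have := h1 z'
    rw [← hp] at this
    exact congrArg (fun z => z.1.2) this
  mk_eq_of_act_eq g p q h := by
    obtain ⟨Φ, -, -, h2⟩ := exists_inverse_quotAct hF hT g
    refine Quotient.exact ((h2 p).symm.trans ((congrArg Φ ?_).trans (h2 q)))
    exact T.beta.part_ext h

end PreAction

/-! ### Translation between partitioned actions and partial maps on the whole space -/

/-- Two descriptions of the fibre product over one of the summands of a disjoint union. -/
def partitionHomeomorph {X Y : Type*} [TopologicalSpace X] [TopologicalSpace Y] {O : C → Type*}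
    {x : C} (s : X → O x) (idx : Y → C) (r : (x : C) → {y // idx y = x} → O x) :
    {p : X × Y // (⟨x, s p.1⟩ : Σ x, O x) = ⟨idx p.2, r _ ⟨p.2, rfl⟩⟩} ≃ₜ
      {p : X × {y // idx y = x} // s p.1 = r x p.2} where
  toFun p := ⟨(p.1.1, ⟨p.1.2, (congrArg Sigma.fst p.2).symm⟩), by
    obtain ⟨⟨γ, y⟩, e⟩ := p
    obtain ⟨rfl, h⟩ := Sigma.mk.inj_iff.1 e
    exact eq_of_heq h⟩
  invFun p := ⟨(p.1.1, p.1.2.1), by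
    obtain ⟨⟨γ, y, rfl⟩, e⟩ := p
    exact congrArg (Sigma.mk _) e⟩
  left_inv _ := rfl
  right_inv _ := rfl
  continuous_toFun := by fun_prop
  continuous_invFun := by fun_prop

namespace Action

variable {Y Z : Type*} [TopologicalSpace Y] [TopologicalSpace Z]

/-- The fibre product on which an action is defined, as a subspace of `F.X g × Y`. -/
def fibreHomeomorph (A : F.Action Y) {x x' : C} (g : x ⟶ x') :
    {p : (F.X g).carrier × Y // F.src g p.1 = A.anchor p.2} ≃ₜ
      {p : (F.X g).carrier × {y // A.idx y = x} // (F.X g).s p.1 = A.r x p.2} :=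
  partitionHomeomorph (O := fun x => (F.G x).Obj) (F.X g).s A.idx A.r

theorem anchor_eq (A : F.Action Y) {x : C} (y : {y // A.idx y = x}) :
    A.anchor y.1 = ⟨x, A.r x y⟩ := by
  obtain ⟨y, rfl⟩ := y
  rfl

/-- The unit law is not an axiom of an action. It follows from surjectivity: write `y = γ · y'` with
`γ` over `𝟙 x` and use that a unit arrow fixes `γ`. -/
theorem act_one (A : F.Action Y) (x : C) (b : (F.G x).Obj) (y : {y // A.idx y = x})
    (e : b = A.r x y) :
    A.act (𝟙 x) (F.ν x ((F.G x).one b)) y (((F.s_ν _ _).trans ((F.G x).s_one b)).trans e) = y := by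
  obtain ⟨γ, y', e', rfl⟩ := A.surjective_act (𝟙 x) y
  obtain rfl : b = (F.X (𝟙 x)).r γ := e.trans (A.r_act ..)
  have key : ∀ {g g' : x ⟶ x} (hg : g = g') (γ : (F.X g).carrier) (γ' : (F.X g').carrier)
      (_ : hg ▸ γ = γ') (e : (F.X g).s γ = A.r x y') (e' : (F.X g').s γ' = A.r x y'),
      A.act g γ y' e = A.act g' γ' y' e' := by
    rintro g _ rfl γ _ rfl _ _
    rfl
  refine (A.act_act (𝟙 x) (𝟙 x) _ γ y' ((F.s_ν _ _).trans ((F.G x).s_one _)) e').trans ?_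
  refine key (Category.comp_id (𝟙 x)) _ _ ?_ _ _
  exact (F.μ_unit_left (𝟙 x) γ _ ((F.G x).s_one _)).trans ((F.X (𝟙 x)).one_lact γ)

/-- The action as a family of partially defined maps on the whole space. -/
def toPreAction (A : F.Action Y) : F.PreAction Y where
  anchor := A.anchor
  act g γ y e := (A.act g γ (A.fibreHomeomorph g ⟨(γ, y), e⟩).1.2
    (A.fibreHomeomorph g ⟨(γ, y), e⟩).2).1
  anchor_act g γ y e := (A.anchor_eq _).trans (congrArg (Sigma.mk _) (A.r_act ..))
  continuous_act g := continuous_subtype_val.comp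
    ((A.continuous_act g).comp (A.fibreHomeomorph g).continuous)
  act_act g₂ g₁ γ₁ γ₂ y e₁ e₂ := congrArg Subtype.val (A.act_act g₂ g₁ γ₁ γ₂ _ e₁ _)
  one_act x b y e := by
    obtain ⟨rfl, h⟩ := Sigma.mk.inj_iff.1 e
    exact congrArg Subtype.val (A.act_one _ b ⟨y, rfl⟩ (eq_of_heq h))

theorem isAction_toPreAction (A : F.Action Y) : A.toPreAction.IsAction where
  isOpenMap_act {x x'} g := ((A.isClopen_idx x').isOpen.isOpenMap_subtype_val).comp
    ((A.isOpenMap_act g).comp (A.fibreHomeomorph g).isOpenMap)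
  surjective_act {x x'} g z hz := by
    obtain ⟨γ, y, e, h⟩ := A.surjective_act g ⟨z, hz⟩
    exact ⟨γ, y.1, ((A.fibreHomeomorph g).symm ⟨(γ, y), e⟩).2, congrArg Subtype.val h⟩
  mk_eq_of_act_eq {x x'} g p q h := by
    obtain ⟨η, h₁, h₂, hγ, hy⟩ := A.exists_of_act_eq g _ _ (A.fibreHomeomorph g p).2 _ _
      (A.fibreHomeomorph g q).2 (Subtype.ext h)
    exact ⟨η, h₁, (congrArg (Sigma.mk x) h₂).trans
      (((congrArg (Sigma.mk x) (A.fibreHomeomorph g q).2).symm.trans q.2)), hγ,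
      congrArg Subtype.val hy⟩

theorem isEquivariant_iff (A : F.Action Y) (B : F.Action Z) (φ : C(Y, Z)) :
    A.IsEquivariant B φ ↔ A.toPreAction.IsEquivariant B.toPreAction φ := by
  constructor
  · intro h
    exact ⟨fun y => (B.anchor_eq ⟨φ y, h.idx_map y⟩).trans
      (congrArg (Sigma.mk _) (h.r_map _ ⟨y, rfl⟩)),
      fun g γ y e => h.act_map g γ _ (A.fibreHomeomorph g ⟨(γ, y), e⟩).2⟩
  · intro h
    have h1 : ∀ y, B.idx (φ y) = A.idx y := fun y => congrArg Sigma.fst (h.anchor_map y)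
    refine ⟨h1, fun x y => ?_, fun g γ y e => ?_⟩
    · exact sigma_mk_injective (β := fun x => (F.G x).Obj)
        ((B.anchor_eq ⟨φ y, (h1 y).trans y.2⟩).symm.trans
          ((h.anchor_map y.1).trans (A.anchor_eq y)))
    · exact h.act_map g γ y.1 ((A.fibreHomeomorph g).symm ⟨(γ, y), e⟩).2

/-- The three equivariance conditions compare all the data of an action; the remaining fields are
propositions. -/
theorem eq_of_isEquivariant_id {A B : F.Action Y} (h : A.IsEquivariant B (ContinuousMap.id Y)) :
    A = B := by
  obtain ⟨h1, h2, h3⟩ := h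
  obtain ⟨idx, _, r, _, act, _, _, _, _, _, _⟩ := A
  obtain ⟨idx', _, r', _, act', _, _, _, _, _, _⟩ := B
  obtain rfl : idx' = idx := funext h1
  obtain rfl : r' = r := funext fun x => funext fun y => h2 x y
  have : @act = @act' := by
    funext x x' g γ y e
    exact Subtype.ext (h3 g γ y e)
  subst this
  rfl

end Action

namespace PreAction

variable {Y : Type*} [TopologicalSpace Y]

theorem isClopen_fst_anchor (T : F.PreAction Y) (x : C) : IsClopen {y | (T.anchor y).1 = x} := by
  have : IsClopen (Sigma.fst ⁻¹' {x} : Set F.Obj) :=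
    ⟨isOpen_compl_iff.1 (isOpen_sigma_fst_preimage {x}ᶜ), isOpen_sigma_fst_preimage {x}⟩
  exact this.preimage T.anchor.continuous

/-- The anchor map on one of the summands of the underlying space. -/
def partAnchor (T : F.PreAction Y) (x : C) (y : {y // (T.anchor y).1 = x}) : (F.G x).Obj :=
  y.2 ▸ (T.anchor y.1).2

theorem eq_partAnchor (T : F.PreAction Y) {x : C} {b : (F.G x).Obj}
    (y : {y // (T.anchor y).1 = x}) (h : ⟨x, b⟩ = T.anchor y.1) : b = T.partAnchor x y := by
  obtain ⟨y, rfl⟩ := y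
  exact sigma_mk_injective (β := fun x => (F.G x).Obj) h

/-- The fibre product on which `T.act g` is defined, as a subspace of a product with one of the
summands of the underlying space. -/
def fibreHomeomorph (T : F.PreAction Y) {x x' : C} (g : x ⟶ x') :
    T.Fibre g ≃ₜ
      {p : (F.X g).carrier × {y // (T.anchor y).1 = x} // (F.X g).s p.1 = T.partAnchor x p.2} :=
  partitionHomeomorph (O := fun x => (F.G x).Obj) (F.X g).s (fun y => (T.anchor y).1) T.partAnchor

/-- The action defined by a family of partially defined maps. -/
def IsAction.toAction {T : F.PreAction Y} (hT : T.IsAction) : F.Action Y where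
  idx y := (T.anchor y).1
  isClopen_idx := T.isClopen_fst_anchor
  r := T.partAnchor
  continuous_r x := by
    rw [(IsEmbedding.sigmaMk (σ := fun x => (F.G x).Obj) (i := x)).continuous_iff]
    refine (T.anchor.continuous.comp continuous_subtype_val).congr ?_
    rintro ⟨y, rfl⟩
    rfl
  act {x x'} g γ y e := ⟨T.act g γ y.1 ((T.fibreHomeomorph g).symm ⟨(γ, y), e⟩).2,
    congrArg Sigma.fst (T.anchor_act ..)⟩
  continuous_act {x x'} g := Continuous.subtype_mk ((T.continuous_act g).comp
    (T.fibreHomeomorph g).symm.continuous) _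
  isOpenMap_act {x x'} g := by
    rw [(T.isClopen_fst_anchor x').isOpen.isOpenEmbedding_subtypeVal.isOpenMap_iff]
    exact (hT.isOpenMap_act g).comp (T.fibreHomeomorph g).symm.isOpenMap
  surjective_act {x x'} g z := by
    obtain ⟨γ, y, e, h⟩ := hT.surjective_act g z.1 z.2
    exact ⟨γ, ⟨y, (congrArg Sigma.fst e).symm⟩, T.eq_partAnchor _ e, Subtype.ext h⟩
  r_act {x x'} g γ y e := (T.eq_partAnchor _ (T.anchor_act ..).symm).symm
  act_act g₂ g₁ γ₁ γ₂ y e₁ e₂ := Subtype.ext (T.act_act g₂ g₁ γ₁ γ₂ y.1 e₁ _)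
  exists_of_act_eq {x x'} g γ y e γ' y' e' h := by
    obtain ⟨η, h₁, h₂, hγ, hy⟩ := hT.mk_eq_of_act_eq g ((T.fibreHomeomorph g).symm ⟨(γ, y), e⟩)
      ((T.fibreHomeomorph g).symm ⟨(γ', y'), e'⟩) (congrArg Subtype.val h)
    exact ⟨η, h₁, T.eq_partAnchor _ h₂, hγ, Subtype.ext hy⟩

end PreAction

/-! ### The induced action and the reflector -/

namespace ActionCat

variable [F.IsLocallyCompact]

/-- The induced action on the relative Stone–Čech compactification. -/
noncomputable def betaAction (hF : F.IsProper) (Y : ActionCat.{w, v, u, t} F) :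
    F.Action Y.Beta :=
  (PreAction.isAction_beta hF Y.action.isAction_toPreAction).toAction

theorem isEquivariant_toBeta (hF : F.IsProper) (Y : ActionCat.{w, v, u, t} F) :
    Y.action.IsEquivariant (Y.betaAction hF) Y.toBeta :=
  (Y.action.isEquivariant_iff _ _).2 Y.action.toPreAction.isEquivariant_unit

/-- The identity of `Y.Beta` extends the unit map. It is therefore equivariant from `B` to the
induced action, and so the two actions coincide. -/
theorem eq_betaAction (hF : F.IsProper) (Y : ActionCat.{w, v, u, t} F) (B : F.Action Y.Beta)
    (hB : Y.action.IsEquivariant B Y.toBeta) : B = Y.betaAction hF := by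
  refine Action.eq_of_isEquivariant_id ((Action.isEquivariant_iff _ _ _).2 ?_)
  exact PreAction.isEquivariant_of_unit (T := Y.action.toPreAction)
    ((Y.action.isEquivariant_iff _ _).1 hB) Y.action.toPreAction.isEquivariant_unit
    (Φ := ContinuousMap.id _) fun _ => rfl

/-- The relative Stone–Čech compactification as an object of the subcategory of Hausdorff spaces
proper over `G⁰`. -/
noncomputable def betaObj (hF : F.IsProper) (Y : ActionCat.{w, v, u, t} F) :
    (properHausdorff.{w, v, u, t} F).FullSubcategory :=
  ⟨⟨Y.Beta, Y.betaAction hF⟩, inferInstanceAs (T2Space Y.Beta),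
    RelStoneCech.isProperMap_anchor Y.action.anchor⟩

/-- The canonical map to the relative Stone–Čech compactification as a morphism of actions. -/
noncomputable def betaUnit (hF : F.IsProper) (Y : ActionCat.{w, v, u, t} F) :
    Y ⟶ (Y.betaObj hF).obj :=
  ⟨Y.toBeta, Y.isEquivariant_toBeta hF⟩

/-- Injectivity is density of `Y` in a situation with Hausdorff target. Surjectivity is the
extension theorem, whose extension is again equivariant by density. -/
theorem bijective_betaUnit_comp (hF : F.IsProper) (Y : ActionCat.{w, v, u, t} F)
    (Z : (properHausdorff.{w, v, u, t} F).FullSubcategory) :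
    Function.Bijective fun f : Y.betaObj hF ⟶ Z => (Y.betaUnit hF ≫ f.hom : Y ⟶ Z.obj) := by
  have hZ := Z.property.1
  constructor
  · intro f g h
    refine ObjectProperty.hom_ext _ (Hom.ext (ContinuousMap.ext (congrFun ?_)))
    refine (RelStoneCech.denseRange_unit Y.action.anchor).equalizer (map_continuous f.hom.map)
      (map_continuous g.hom.map) (funext fun y => ?_)
    exact DFunLike.congr_fun (congrArg Hom.map h) y
  · intro φ
    have hφ := (Action.isEquivariant_iff _ _ _).1 φ.equivariant
    obtain ⟨Φ, hΦ⟩ := PreAction.exists_extension Y.action.toPreAction Z.property.2 hφ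
    have h : (Y.betaAction hF).IsEquivariant Z.obj.action Φ := (Action.isEquivariant_iff _ _ _).2
      (PreAction.isEquivariant_of_unit Y.action.toPreAction.isEquivariant_unit hφ hΦ)
    exact ⟨ObjectProperty.homMk ⟨Φ, h⟩, Hom.ext (ContinuousMap.ext hΦ)⟩

/-- The relative Stone–Čech compactification makes the Hausdorff spaces proper over `G⁰` a
reflective subcategory. -/
noncomputable abbrev reflective (hF : F.IsProper) :
    Reflective (properHausdorff.{w, v, u, t} F).ι where
  L := Adjunction.leftAdjointOfEquiv (F_obj := betaObj hF)
    (fun Y Z => Equiv.ofBijective _ (bijective_betaUnit_comp hF Y Z))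
    fun Y _ _ g f => (Category.assoc (Y.betaUnit hF) f.hom g.hom).symm
  adj := Adjunction.adjunctionOfEquivLeft _ _

end ActionCat

end CorrDiagram

theorem mainTheorem5 {C : Type u} [Category.{v} C] (F : CorrDiagram.{w} C)
    [F.IsLocallyCompact] (hF : F.IsProper) :
    ∃ A : (Y : CorrDiagram.ActionCat.{w, v, u, t} F) → F.Action Y.Beta,
      (∀ Y, Y.action.IsEquivariant (A Y) Y.toBeta ∧
        ∀ B : F.Action Y.Beta, Y.action.IsEquivariant B Y.toBeta → B = A Y) ∧
      ∃ _ : Reflective (CorrDiagram.properHausdorff.{w, v, u, t} F).ι,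
        ∀ Y : CorrDiagram.ActionCat.{w, v, u, t} F,
          ∃ e : ((reflector (CorrDiagram.properHausdorff F).ι).obj Y).obj = ⟨Y.Beta, A Y⟩,
            ((reflectorAdjunction (CorrDiagram.properHausdorff F).ι).unit.app Y ≫ eqToHom e).map
              = Y.toBeta := by
  -- The left adjoint is built with `betaObj` as its object map, and its unit is the image of an
  -- identity under composition with `betaUnit`. Both required equalities are therefore
  -- definitional.
  exact ⟨CorrDiagram.ActionCat.betaAction hF, fun Y => ⟨Y.isEquivariant_toBeta hF,
    Y.eq_betaAction hF⟩, CorrDiagram.ActionCat.reflective hF, fun Y => ⟨rfl, rfl⟩⟩
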